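/- All $3$-categories are small and strict; $\ast_i$ denotes $i$-composition ($y \ast_i x$ is "$y$ after $x$"), $1_x$ the identity of $x$, $\ast_0$ binds tighter than $\ast_1$ and $\ast_1$ tighter than $\ast_2$, lower cells in a composite stand for their iterated identities, and $gf := g \ast_0 f$ for $1$-cells. A $1$-category is regarded as a $3$-category all of whose $2$- and $3$-cells are identities. **Definition.** Let $A$, $B$ be $3$-categories. A *normalised oplax $3$-functor* $F \colon A \to B$ consists of the following data: an object $F(a)$ for each object $a$; a $1$-cell $F(f) \colon F(a) \to F(a')$ for each $1$-cell $f \colon a \to a'$; a $2$-cell $F(\alpha) \colon F(f) \to F(f')$ for each $2$-cell $\alpha \colon f \to f'$; a $3$-cell $F(\Gamma) \colon F(\alpha) \to F(\alpha')$ for each $3$-cell $\Gamma \colon \alpha \to \alpha'$; for composable $1$-cells $f, g, h$ (in this order), a $2$-cell $F(g,f) \colon F(gf) \to F(g) \ast_0 F(f)$ and a $3$-cell $$F(h,g,f) \colon F(h) \ast_0 F(g,f) \ast_1 F(h, gf) \to F(h,g) \ast_0 F(f) \ast_1 F(hg, f);$$ for $\alpha \colon f \to f' \colon a \to a'$ and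 $g \colon a' \to a''$, a $3$-cell $$F(g, \alpha) \colon F(g) \ast_0 F(\alpha) \ast_1 F(g,f) \to F(g,f') \ast_1 F(g \ast_0 \alpha);$$ for $f \colon a \to a'$ and $\beta \colon g \to g' \colon a' \to a''$, a $3$-cell $$F(\beta, f) \colon F(g',f) \ast_1 F(\beta \ast_0 f) \to F(\beta) \ast_0 F(f) \ast_1 F(g,f).$$ *Normalisation.* $F(1_x) = 1_{F(x)}$ for every object, $1$-cell or $2$-cell $x$; $F(1_{a'}, f) = F(f, 1_a) = 1_{F(f)}$; $F(g,f,1_a) = F(g,1_{a'},f) = F(1_{a''},g,f) = 1_{F(g,f)}$; $F(g, 1_f) = 1_{F(g,f)}$ and $F(1_{a'}, \alpha) = 1_{F(\alpha)}$; $F(1_g, f) = 1_{F(g,f)}$ and $F(\beta, 1_{a'}) = 1_{F(\beta)}$. *Coherences*, for all cells of $A$ for which the expressions make sense: 1. $F(\beta) \ast_1 F(\alpha) = F(\beta \ast_1 \alpha)$ for $1$-composable $2$-cells (the induced equality of identity $3$-cells for three $1$-composable $2$-cells is then automatic). 2. For composable $1$-cells $f,g,h,i$, the $3$-cell $$\bigl(F(i,h)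 \ast_0 F(g) \ast_0 F(f) \ast_1 F(ih,g,f)\bigr) \ast_2 \bigl(F(i) \ast_0 F(h) \ast_0 F(g,f) \ast_1 F(i,h,gf)\bigr)$$ equals $$\bigl(F(i,h,g) \ast_0 F(f) \ast_1 F(ihg,f)\bigr) \ast_2 \bigl(F(i) \ast_0 F(h,g) \ast_0 F(f) \ast_1 F(i,hg,f)\bigr) \ast_2 \bigl(F(i) \ast_0 F(h,g,f) \ast_1 F(i,hgf)\bigr).$$ 3. For $1$-cells $f, g$ followed by a $2$-cell $\alpha \colon h \to h'$, the $3$-cell $$\bigl(F(\alpha) \ast_0 F(g) \ast_0 F(f) \ast_1 F(h,g,f)\bigr) \ast_2 \bigl(F(h') \ast_0 F(g,f) \ast_1 F(\alpha,gf)\bigr)$$ equals $$\bigl(F(\alpha,g) \ast_0 F(f) \ast_1 F(hg,f)\bigr) \ast_2 \bigl(F(h',g) \ast_0 F(f) \ast_1 F(\alpha \ast_0 g,f)\bigr) \ast_2 \bigl(F(h',g,f) \ast_1 F(\alpha \ast_0 g \ast_0 f)\bigr).$$ 4. For a $1$-cell $f$, then a $2$-cell $\alpha \colon g \to g'$, then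 a $1$-cell $h$, the $3$-cell $$\bigl(F(h,g') \ast_0 F(f) \ast_1 F(h \ast_0 \alpha,f)\bigr) \ast_2 \bigl(F(h,g',f) \ast_1 F(h \ast_0 \alpha \ast_0 f)\bigr) \ast_2 \bigl(F(h) \ast_0 F(g',f) \ast_1 F(h,\alpha \ast_0 f)\bigr)$$ equals $$\bigl(F(h,\alpha) \ast_0 F(f) \ast_1 F(hg,f)\bigr) \ast_2 \bigl(F(h) \ast_0 F(\alpha) \ast_0 F(f) \ast_1 F(h,g,f)\bigr) \ast_2 \bigl(F(h) \ast_0 F(\alpha,f) \ast_1 F(h,gf)\bigr).$$ 5. For a $2$-cell $\alpha \colon f \to f'$ followed by $1$-cells $g$, $h$, the $3$-cell $$\bigl(F(h,g) \ast_0 F(f') \ast_1 F(hg,\alpha)\bigr) \ast_2 \bigl(F(h) \ast_0 F(g) \ast_0 F(\alpha) \ast_1 F(h,g,f)\bigr)$$ equals $$\bigl(F(h,g,f') \ast_1 F(h \ast_0 g \ast_0 \alpha)\bigr) \ast_2 \bigl(F(h) \ast_0 F(g,f') \ast_1 F(h,g \ast_0 \alpha)\bigr) \ast_2 \bigl(F(h)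 \ast_0 F(g,\alpha) \ast_1 F(h,gf)\bigr).$$ 6. For $1$-composable $\alpha, \beta$: $F(g,\beta \ast_1 \alpha) = \bigl(F(g,\beta) \ast_1 F(g \ast_0 \alpha)\bigr) \ast_2 \bigl(F(g) \ast_0 F(\beta) \ast_1 F(g,\alpha)\bigr)$ and $F(\beta \ast_1 \alpha,f) = \bigl(F(\beta) \ast_0 F(f) \ast_1 F(\alpha,f)\bigr) \ast_2 \bigl(F(\beta,f) \ast_1 F(\alpha \ast_0 f)\bigr)$. 7. For $\alpha \colon f \to f'$ and $\beta \colon g \to g'$ that are $0$-composable, the $3$-cell $$\bigl(F(\beta) \ast_0 F(f') \ast_1 F(g,\alpha)\bigr) \ast_2 \bigl(F(g') \ast_0 F(\alpha) \ast_1 F(\beta,f)\bigr)$$ equals $$\bigl(F(\beta,f') \ast_1 F(g \ast_0 \alpha)\bigr) \ast_2 \bigl(F(g',\alpha) \ast_1 F(\beta \ast_0 f)\bigr).$$ 8. $F(\Delta \ast_2 \Gamma) = F(\Delta) \ast_2 F(\Gamma)$, $F(\Gamma \ast_1 \alpha) = F(\Gamma) \ast_1 F(\alpha)$ and $F(\beta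 \ast_1 \Gamma) = F(\beta) \ast_1 F(\Gamma)$ for $2$-cells $\alpha,\beta$ and $3$-cells $\Gamma,\Delta$. 9. For a $1$-cell $f$ followed by a $3$-cell $\Gamma \colon \beta \to \beta'$ between $2$-cells $g \to g'$: $F(\beta',f) \ast_2 \bigl(F(g',f) \ast_1 F(\Gamma \ast_0 f)\bigr) = \bigl(F(\Gamma) \ast_0 F(f) \ast_1 F(g,f)\bigr) \ast_2 F(\beta,f)$. 10. For a $3$-cell $\Gamma \colon \alpha \to \alpha'$ between $2$-cells $f \to f'$, followed by a $1$-cell $g$: $\bigl(F(g,f') \ast_1 F(g \ast_0 \Gamma)\bigr) \ast_2 F(g,\alpha) = F(g,\alpha') \ast_2 \bigl(F(g) \ast_0 F(\Gamma) \ast_1 F(g,f)\bigr)$. **Proposition.** Let $A$ be a $1$-category, let $B$ and $C$ be $3$-categories, and let $F \colon A \to B$ and $G \colon B \to C$ be normalised oplax $3$-functors. Define, for an object $a$ and composable $1$-cells $f, g, h$ of $A$, $$GF(a) = G(F(a)), \qquad GF(f) = G(F(f)), \qquad GF(g,f) = G\bigl(F(g),F(f)\bigr) \ast_1 G\bigl(F(g,f)\bigr),$$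 and let $GF(h,g,f)$ be the $3$-cell $$\begin{aligned} &\bigl(G(F(h),F(g)) \ast_0 GF(f) \ast_1 G(F(h,g),F(f)) \ast_1 G(F(hg,f))\bigr)\\ \ast_2\ &\bigl(G(F(h),F(g),F(f)) \ast_1 G(F(h,g,f))\bigr)\\ \ast_2\ &\bigl(GF(h) \ast_0 G(F(g),F(f)) \ast_1 G(F(h),F(g,f)) \ast_1 G(F(h,gf))\bigr). \end{aligned}$$ Then these data define a normalised oplax $3$-functor $GF \colon A \to C$: there is one, and only one (its values on the identity $2$- and $3$-cells of $A$ being forced by normalisation), normalised oplax $3$-functor $A \to C$ with these values on objects, $1$-cells, composable pairs and composable triples of $1$-cells. -/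

import Mathlib

universe u u₁ u₂ u₃

/-- A small strict `3`-category, presented as a category enriched in strict `2`-categories:
for objects `a` and `b`, the `1`-, `2`- and `3`-cells with `0`-source `a` and `0`-target `b` form
the strict `2`-category of maps from `a` to `b`, and `0`-composition is `2`-functorial.

The operation `compⱼᵢ` is the `i`-composition of `j`-cells; `compⱼᵢ y x` is "`y` after `x`".
The `0`-compositions are defined on composable cells by typing. The operations `comp₂₁`, `comp₃₁`
and `comp₃₂` are only meaningful on pairs `y`, `x` such that the target of `x` (of the relevant
dimension) is the source of `y`: their values on other pairs are irrelevant, and no axiom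
constrains them. -/
structure ThreeCat where
  /-- objects -/
  Obj : Type u
  /-- `1`-cells -/
  Hom : Obj → Obj → Type u
  /-- `2`-cells with given `0`-source and `0`-target -/
  Cell₂ : Obj → Obj → Type u
  /-- `3`-cells with given `0`-source and `0`-target -/
  Cell₃ : Obj → Obj → Type u
  /-- source of a `2`-cell -/
  src₁ {a b : Obj} : Cell₂ a b → Hom a b
  /-- target of a `2`-cell -/
  tgt₁ {a b : Obj} : Cell₂ a b → Hom a b
  /-- source of a `3`-cell -/
  src₂ {a b : Obj} : Cell₃ a b → Cell₂ a b
  /-- target of a `3`-cell -/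
  tgt₂ {a b : Obj} : Cell₃ a b → Cell₂ a b
  /-- identity `1`-cells -/
  id₁ (a : Obj) : Hom a a
  /-- identity `2`-cells -/
  id₂ {a b : Obj} : Hom a b → Cell₂ a b
  /-- identity `3`-cells -/
  id₃ {a b : Obj} : Cell₂ a b → Cell₃ a b
  /-- `0`-composition of `1`-cells -/
  comp₁₀ {a b c : Obj} : Hom b c → Hom a b → Hom a c
  /-- `0`-composition of `2`-cells -/
  comp₂₀ {a b c : Obj} : Cell₂ b c → Cell₂ a b → Cell₂ a c
  /-- `0`-composition of `3`-cells -/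
  comp₃₀ {a b c : Obj} : Cell₃ b c → Cell₃ a b → Cell₃ a c
  /-- `1`-composition of `2`-cells -/
  comp₂₁ {a b : Obj} : Cell₂ a b → Cell₂ a b → Cell₂ a b
  /-- `1`-composition of `3`-cells -/
  comp₃₁ {a b : Obj} : Cell₃ a b → Cell₃ a b → Cell₃ a b
  /-- `2`-composition of `3`-cells -/
  comp₃₂ {a b : Obj} : Cell₃ a b → Cell₃ a b → Cell₃ a b
  -- globularity
  src₁_src₂ {a b : Obj} (Γ : Cell₃ a b) : src₁ (src₂ Γ) = src₁ (tgt₂ Γ)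
  tgt₁_src₂ {a b : Obj} (Γ : Cell₃ a b) : tgt₁ (src₂ Γ) = tgt₁ (tgt₂ Γ)
  -- sources and targets of identities
  src₁_id₂ {a b : Obj} (f : Hom a b) : src₁ (id₂ f) = f
  tgt₁_id₂ {a b : Obj} (f : Hom a b) : tgt₁ (id₂ f) = f
  src₂_id₃ {a b : Obj} (α : Cell₂ a b) : src₂ (id₃ α) = α
  tgt₂_id₃ {a b : Obj} (α : Cell₂ a b) : tgt₂ (id₃ α) = α
  -- sources and targets of composites
  src₁_comp₂₀ {a b c : Obj} (β : Cell₂ b c) (α : Cell₂ a b) :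
    src₁ (comp₂₀ β α) = comp₁₀ (src₁ β) (src₁ α)
  tgt₁_comp₂₀ {a b c : Obj} (β : Cell₂ b c) (α : Cell₂ a b) :
    tgt₁ (comp₂₀ β α) = comp₁₀ (tgt₁ β) (tgt₁ α)
  src₂_comp₃₀ {a b c : Obj} (Δ : Cell₃ b c) (Γ : Cell₃ a b) :
    src₂ (comp₃₀ Δ Γ) = comp₂₀ (src₂ Δ) (src₂ Γ)
  tgt₂_comp₃₀ {a b c : Obj} (Δ : Cell₃ b c) (Γ : Cell₃ a b) :
    tgt₂ (comp₃₀ Δ Γ) = comp₂₀ (tgt₂ Δ) (tgt₂ Γ)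
  src₁_comp₂₁ {a b : Obj} (β α : Cell₂ a b) (h : tgt₁ α = src₁ β) :
    src₁ (comp₂₁ β α) = src₁ α
  tgt₁_comp₂₁ {a b : Obj} (β α : Cell₂ a b) (h : tgt₁ α = src₁ β) :
    tgt₁ (comp₂₁ β α) = tgt₁ β
  src₂_comp₃₁ {a b : Obj} (Δ Γ : Cell₃ a b) (h : tgt₁ (src₂ Γ) = src₁ (src₂ Δ)) :
    src₂ (comp₃₁ Δ Γ) = comp₂₁ (src₂ Δ) (src₂ Γ)
  tgt₂_comp₃₁ {a b : Obj} (Δ Γ : Cell₃ a b) (h : tgt₁ (src₂ Γ) = src₁ (src₂ Δ)) :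
    tgt₂ (comp₃₁ Δ Γ) = comp₂₁ (tgt₂ Δ) (tgt₂ Γ)
  src₂_comp₃₂ {a b : Obj} (Δ Γ : Cell₃ a b) (h : tgt₂ Γ = src₂ Δ) :
    src₂ (comp₃₂ Δ Γ) = src₂ Γ
  tgt₂_comp₃₂ {a b : Obj} (Δ Γ : Cell₃ a b) (h : tgt₂ Γ = src₂ Δ) :
    tgt₂ (comp₃₂ Δ Γ) = tgt₂ Δ
  -- unit laws
  id_comp₁₀ {a b : Obj} (f : Hom a b) : comp₁₀ (id₁ b) f = f
  comp₁₀_id {a b : Obj} (f : Hom a b) : comp₁₀ f (id₁ a) = f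
  id_comp₂₀ {a b : Obj} (α : Cell₂ a b) : comp₂₀ (id₂ (id₁ b)) α = α
  comp₂₀_id {a b : Obj} (α : Cell₂ a b) : comp₂₀ α (id₂ (id₁ a)) = α
  id_comp₃₀ {a b : Obj} (Γ : Cell₃ a b) : comp₃₀ (id₃ (id₂ (id₁ b))) Γ = Γ
  comp₃₀_id {a b : Obj} (Γ : Cell₃ a b) : comp₃₀ Γ (id₃ (id₂ (id₁ a))) = Γ
  id_comp₂₁ {a b : Obj} (α : Cell₂ a b) : comp₂₁ (id₂ (tgt₁ α)) α = α
  comp₂₁_id {a b : Obj} (α : Cell₂ a b) : comp₂₁ α (id₂ (src₁ α)) = α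
  id_comp₃₁ {a b : Obj} (Γ : Cell₃ a b) : comp₃₁ (id₃ (id₂ (tgt₁ (src₂ Γ)))) Γ = Γ
  comp₃₁_id {a b : Obj} (Γ : Cell₃ a b) : comp₃₁ Γ (id₃ (id₂ (src₁ (src₂ Γ)))) = Γ
  id_comp₃₂ {a b : Obj} (Γ : Cell₃ a b) : comp₃₂ (id₃ (tgt₂ Γ)) Γ = Γ
  comp₃₂_id {a b : Obj} (Γ : Cell₃ a b) : comp₃₂ Γ (id₃ (src₂ Γ)) = Γ
  -- composites of identities
  id₂_comp₁₀ {a b c : Obj} (g : Hom b c) (f : Hom a b) :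
    id₂ (comp₁₀ g f) = comp₂₀ (id₂ g) (id₂ f)
  id₃_comp₂₀ {a b c : Obj} (β : Cell₂ b c) (α : Cell₂ a b) :
    id₃ (comp₂₀ β α) = comp₃₀ (id₃ β) (id₃ α)
  id₃_comp₂₁ {a b : Obj} (β α : Cell₂ a b) (h : tgt₁ α = src₁ β) :
    id₃ (comp₂₁ β α) = comp₃₁ (id₃ β) (id₃ α)
  -- associativity
  assoc₁₀ {a b c d : Obj} (h : Hom c d) (g : Hom b c) (f : Hom a b) :
    comp₁₀ (comp₁₀ h g) f = comp₁₀ h (comp₁₀ g f)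
  assoc₂₀ {a b c d : Obj} (γ : Cell₂ c d) (β : Cell₂ b c) (α : Cell₂ a b) :
    comp₂₀ (comp₂₀ γ β) α = comp₂₀ γ (comp₂₀ β α)
  assoc₃₀ {a b c d : Obj} (Θ : Cell₃ c d) (Δ : Cell₃ b c) (Γ : Cell₃ a b) :
    comp₃₀ (comp₃₀ Θ Δ) Γ = comp₃₀ Θ (comp₃₀ Δ Γ)
  assoc₂₁ {a b : Obj} (γ β α : Cell₂ a b) (h : tgt₁ α = src₁ β) (h' : tgt₁ β = src₁ γ) :
    comp₂₁ (comp₂₁ γ β) α = comp₂₁ γ (comp₂₁ β α)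
  assoc₃₁ {a b : Obj} (Θ Δ Γ : Cell₃ a b) (h : tgt₁ (src₂ Γ) = src₁ (src₂ Δ))
    (h' : tgt₁ (src₂ Δ) = src₁ (src₂ Θ)) :
    comp₃₁ (comp₃₁ Θ Δ) Γ = comp₃₁ Θ (comp₃₁ Δ Γ)
  assoc₃₂ {a b : Obj} (Θ Δ Γ : Cell₃ a b) (h : tgt₂ Γ = src₂ Δ) (h' : tgt₂ Δ = src₂ Θ) :
    comp₃₂ (comp₃₂ Θ Δ) Γ = comp₃₂ Θ (comp₃₂ Δ Γ)
  -- interchange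
  interchange₂ {a b c : Obj} (β' β : Cell₂ b c) (α' α : Cell₂ a b)
    (hβ : tgt₁ β = src₁ β') (hα : tgt₁ α = src₁ α') :
    comp₂₀ (comp₂₁ β' β) (comp₂₁ α' α) = comp₂₁ (comp₂₀ β' α') (comp₂₀ β α)
  interchange₃₀₁ {a b c : Obj} (Δ' Δ : Cell₃ b c) (Γ' Γ : Cell₃ a b)
    (hΔ : tgt₁ (src₂ Δ) = src₁ (src₂ Δ')) (hΓ : tgt₁ (src₂ Γ) = src₁ (src₂ Γ')) :
    comp₃₀ (comp₃₁ Δ' Δ) (comp₃₁ Γ' Γ) = comp₃₁ (comp₃₀ Δ' Γ') (comp₃₀ Δ Γ)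
  interchange₃₀₂ {a b c : Obj} (Δ' Δ : Cell₃ b c) (Γ' Γ : Cell₃ a b)
    (hΔ : tgt₂ Δ = src₂ Δ') (hΓ : tgt₂ Γ = src₂ Γ') :
    comp₃₀ (comp₃₂ Δ' Δ) (comp₃₂ Γ' Γ) = comp₃₂ (comp₃₀ Δ' Γ') (comp₃₀ Δ Γ)
  interchange₃₁₂ {a b : Obj} (Δ' Δ Γ' Γ : Cell₃ a b)
    (hΔ : tgt₂ Δ = src₂ Δ') (hΓ : tgt₂ Γ = src₂ Γ') (h : tgt₁ (src₂ Γ) = src₁ (src₂ Δ)) :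
    comp₃₁ (comp₃₂ Δ' Δ) (comp₃₂ Γ' Γ) = comp₃₂ (comp₃₁ Δ' Γ') (comp₃₁ Δ Γ)

-- As in the usual convention, `0`-composition binds tighter than `1`-composition, which binds
-- tighter than `2`-composition. Whiskerings are written with explicit identity cells.
infixr:80 " ∘₁₀ " => ThreeCat.comp₁₀ _
infixr:80 " ∘₂₀ " => ThreeCat.comp₂₀ _
infixr:80 " ∘₃₀ " => ThreeCat.comp₃₀ _
infixr:75 " ∘₂₁ " => ThreeCat.comp₂₁ _
infixr:75 " ∘₃₁ " => ThreeCat.comp₃₁ _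
infixr:70 " ∘₃₂ " => ThreeCat.comp₃₂ _

/-- A `3`-category is a `1`-category if all its `2`-cells and all its `3`-cells are identities. -/
structure ThreeCat.IsOneCategory (A : ThreeCat.{u}) : Prop where
  cell₂_eq {a b : A.Obj} (α : A.Cell₂ a b) : ∃ f : A.Hom a b, α = A.id₂ f
  cell₃_eq {a b : A.Obj} (Γ : A.Cell₃ a b) : ∃ α : A.Cell₂ a b, Γ = A.id₃ α

/-- The part of the data of an oplax `3`-functor that involves only objects and `1`-cells of the
source. -/
structure OplaxData₁ (A : ThreeCat.{u₁}) (B : ThreeCat.{u₂}) where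
  /-- the image of an object -/
  obj : A.Obj → B.Obj
  /-- the image of a `1`-cell -/
  map {a b : A.Obj} : A.Hom a b → B.Hom (obj a) (obj b)
  /-- the `2`-cell attached to two composable `1`-cells -/
  V {a b c : A.Obj} (g : A.Hom b c) (f : A.Hom a b) : B.Cell₂ (obj a) (obj c)
  /-- the `3`-cell attached to three composable `1`-cells -/
  W {a b c d : A.Obj} (h : A.Hom c d) (g : A.Hom b c) (f : A.Hom a b) :
    B.Cell₃ (obj a) (obj d)

/-- The data of an oplax `3`-functor. -/
structure OplaxData (A : ThreeCat.{u₁}) (B : ThreeCat.{u₂}) extends OplaxData₁ A B where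
  /-- the image of a `2`-cell -/
  map₂ {a b : A.Obj} : A.Cell₂ a b → B.Cell₂ (obj a) (obj b)
  /-- the `3`-cell attached to a `2`-cell `α` followed by a `1`-cell `g` -/
  VR {a b c : A.Obj} (g : A.Hom b c) (α : A.Cell₂ a b) : B.Cell₃ (obj a) (obj c)
  /-- the `3`-cell attached to a `1`-cell `f` followed by a `2`-cell `β` -/
  VL {a b c : A.Obj} (β : A.Cell₂ b c) (f : A.Hom a b) : B.Cell₃ (obj a) (obj c)
  /-- the image of a `3`-cell -/
  map₃ {a b : A.Obj} : A.Cell₃ a b → B.Cell₃ (obj a) (obj b)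

/-- Data as above form a normalised oplax `3`-functor: the structural cells have the prescribed
sources and targets, and the normalisation and coherence conditions hold. -/
structure OplaxData.IsNormalisedOplax {A : ThreeCat.{u₁}} {B : ThreeCat.{u₂}}
    (F : OplaxData A B) : Prop where
  -- sources and targets
  src_V {a b c : A.Obj} (g : A.Hom b c) (f : A.Hom a b) :
    B.src₁ (F.V g f) = F.map (g ∘₁₀ f)
  tgt_V {a b c : A.Obj} (g : A.Hom b c) (f : A.Hom a b) :
    B.tgt₁ (F.V g f) = F.map g ∘₁₀ F.map f
  src_map₂ {a b : A.Obj} (α : A.Cell₂ a b) : B.src₁ (F.map₂ α) = F.map (A.src₁ α)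
  tgt_map₂ {a b : A.Obj} (α : A.Cell₂ a b) : B.tgt₁ (F.map₂ α) = F.map (A.tgt₁ α)
  src_W {a b c d : A.Obj} (h : A.Hom c d) (g : A.Hom b c) (f : A.Hom a b) :
    B.src₂ (F.W h g f) = B.id₂ (F.map h) ∘₂₀ F.V g f ∘₂₁ F.V h (g ∘₁₀ f)
  tgt_W {a b c d : A.Obj} (h : A.Hom c d) (g : A.Hom b c) (f : A.Hom a b) :
    B.tgt₂ (F.W h g f) = F.V h g ∘₂₀ B.id₂ (F.map f) ∘₂₁ F.V (h ∘₁₀ g) f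
  src_VR {a b c : A.Obj} (g : A.Hom b c) (α : A.Cell₂ a b) :
    B.src₂ (F.VR g α) = B.id₂ (F.map g) ∘₂₀ F.map₂ α ∘₂₁ F.V g (A.src₁ α)
  tgt_VR {a b c : A.Obj} (g : A.Hom b c) (α : A.Cell₂ a b) :
    B.tgt₂ (F.VR g α) = F.V g (A.tgt₁ α) ∘₂₁ F.map₂ (A.id₂ g ∘₂₀ α)
  src_VL {a b c : A.Obj} (β : A.Cell₂ b c) (f : A.Hom a b) :
    B.src₂ (F.VL β f) = F.V (A.tgt₁ β) f ∘₂₁ F.map₂ (β ∘₂₀ A.id₂ f)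
  tgt_VL {a b c : A.Obj} (β : A.Cell₂ b c) (f : A.Hom a b) :
    B.tgt₂ (F.VL β f) = F.map₂ β ∘₂₀ B.id₂ (F.map f) ∘₂₁ F.V (A.src₁ β) f
  src_map₃ {a b : A.Obj} (Γ : A.Cell₃ a b) : B.src₂ (F.map₃ Γ) = F.map₂ (A.src₂ Γ)
  tgt_map₃ {a b : A.Obj} (Γ : A.Cell₃ a b) : B.tgt₂ (F.map₃ Γ) = F.map₂ (A.tgt₂ Γ)
  -- normalisation
  map_id (a : A.Obj) : F.map (A.id₁ a) = B.id₁ (F.obj a)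
  map₂_id {a b : A.Obj} (f : A.Hom a b) : F.map₂ (A.id₂ f) = B.id₂ (F.map f)
  V_id_left {a b : A.Obj} (f : A.Hom a b) : F.V (A.id₁ b) f = B.id₂ (F.map f)
  V_id_right {a b : A.Obj} (f : A.Hom a b) : F.V f (A.id₁ a) = B.id₂ (F.map f)
  map₃_id {a b : A.Obj} (α : A.Cell₂ a b) : F.map₃ (A.id₃ α) = B.id₃ (F.map₂ α)
  W_id_right {a b c : A.Obj} (g : A.Hom b c) (f : A.Hom a b) :
    F.W g f (A.id₁ a) = B.id₃ (F.V g f)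
  W_id_middle {a b c : A.Obj} (g : A.Hom b c) (f : A.Hom a b) :
    F.W g (A.id₁ b) f = B.id₃ (F.V g f)
  W_id_left {a b c : A.Obj} (g : A.Hom b c) (f : A.Hom a b) :
    F.W (A.id₁ c) g f = B.id₃ (F.V g f)
  VR_id₂ {a b c : A.Obj} (g : A.Hom b c) (f : A.Hom a b) :
    F.VR g (A.id₂ f) = B.id₃ (F.V g f)
  VR_id₁ {a b : A.Obj} (α : A.Cell₂ a b) : F.VR (A.id₁ b) α = B.id₃ (F.map₂ α)
  VL_id₂ {a b c : A.Obj} (g : A.Hom b c) (f : A.Hom a b) :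
    F.VL (A.id₂ g) f = B.id₃ (F.V g f)
  VL_id₁ {a b : A.Obj} (β : A.Cell₂ a b) : F.VL β (A.id₁ a) = B.id₃ (F.map₂ β)
  -- vertical composition of two `2`-cells
  coh_Y {a b : A.Obj} (β α : A.Cell₂ a b) (h : A.tgt₁ α = A.src₁ β) :
    F.map₂ β ∘₂₁ F.map₂ α = F.map₂ (β ∘₂₁ α)
  -- four composable `1`-cells
  coh_1111 {a b c d e : A.Obj}
      (i : A.Hom d e) (h : A.Hom c d) (g : A.Hom b c) (f : A.Hom a b) :
    (B.id₃ (F.V i h ∘₂₀ B.id₂ (F.map g) ∘₂₀ B.id₂ (F.map f)) ∘₃₁ F.W (i ∘₁₀ h) g f)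
      ∘₃₂ (B.id₃ (B.id₂ (F.map i) ∘₂₀ B.id₂ (F.map h) ∘₂₀ F.V g f) ∘₃₁ F.W i h (g ∘₁₀ f))
    = (F.W i h g ∘₃₀ B.id₃ (B.id₂ (F.map f)) ∘₃₁ B.id₃ (F.V (i ∘₁₀ h ∘₁₀ g) f))
      ∘₃₂ (B.id₃ (B.id₂ (F.map i) ∘₂₀ F.V h g ∘₂₀ B.id₂ (F.map f)) ∘₃₁ F.W i (h ∘₁₀ g) f)
      ∘₃₂ (B.id₃ (B.id₂ (F.map i)) ∘₃₀ F.W h g f ∘₃₁ B.id₃ (F.V i (h ∘₁₀ g ∘₁₀ f)))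
  -- two `1`-cells followed by a `2`-cell
  coh_211 {a b c d : A.Obj} (α : A.Cell₂ c d) (g : A.Hom b c) (f : A.Hom a b) :
    (B.id₃ (F.map₂ α ∘₂₀ B.id₂ (F.map g) ∘₂₀ B.id₂ (F.map f)) ∘₃₁ F.W (A.src₁ α) g f)
      ∘₃₂ (B.id₃ (B.id₂ (F.map (A.tgt₁ α)) ∘₂₀ F.V g f) ∘₃₁ F.VL α (g ∘₁₀ f))
    = (F.VL α g ∘₃₀ B.id₃ (B.id₂ (F.map f)) ∘₃₁ B.id₃ (F.V (A.src₁ α ∘₁₀ g) f))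
      ∘₃₂ (B.id₃ (F.V (A.tgt₁ α) g ∘₂₀ B.id₂ (F.map f)) ∘₃₁ F.VL (α ∘₂₀ A.id₂ g) f)
      ∘₃₂ (F.W (A.tgt₁ α) g f ∘₃₁ B.id₃ (F.map₂ (α ∘₂₀ A.id₂ g ∘₂₀ A.id₂ f)))
  -- a `1`-cell followed by a `2`-cell followed by a `1`-cell
  coh_121 {a b c d : A.Obj} (h : A.Hom c d) (α : A.Cell₂ b c) (f : A.Hom a b) :
    (B.id₃ (F.V h (A.tgt₁ α) ∘₂₀ B.id₂ (F.map f)) ∘₃₁ F.VL (A.id₂ h ∘₂₀ α) f)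
      ∘₃₂ (F.W h (A.tgt₁ α) f ∘₃₁ B.id₃ (F.map₂ (A.id₂ h ∘₂₀ α ∘₂₀ A.id₂ f)))
      ∘₃₂ (B.id₃ (B.id₂ (F.map h) ∘₂₀ F.V (A.tgt₁ α) f) ∘₃₁ F.VR h (α ∘₂₀ A.id₂ f))
    = (F.VR h α ∘₃₀ B.id₃ (B.id₂ (F.map f)) ∘₃₁ B.id₃ (F.V (h ∘₁₀ A.src₁ α) f))
      ∘₃₂ (B.id₃ (B.id₂ (F.map h) ∘₂₀ F.map₂ α ∘₂₀ B.id₂ (F.map f)) ∘₃₁ F.W h (A.src₁ α) f)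
      ∘₃₂ (B.id₃ (B.id₂ (F.map h)) ∘₃₀ F.VL α f ∘₃₁ B.id₃ (F.V h (A.src₁ α ∘₁₀ f)))
  -- a `2`-cell followed by two `1`-cells
  coh_112 {a b c d : A.Obj} (h : A.Hom c d) (g : A.Hom b c) (α : A.Cell₂ a b) :
    (B.id₃ (F.V h g ∘₂₀ B.id₂ (F.map (A.tgt₁ α))) ∘₃₁ F.VR (h ∘₁₀ g) α)
      ∘₃₂ (B.id₃ (B.id₂ (F.map h) ∘₂₀ B.id₂ (F.map g) ∘₂₀ F.map₂ α) ∘₃₁ F.W h g (A.src₁ α))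
    = (F.W h g (A.tgt₁ α) ∘₃₁ B.id₃ (F.map₂ (A.id₂ h ∘₂₀ A.id₂ g ∘₂₀ α)))
      ∘₃₂ (B.id₃ (B.id₂ (F.map h) ∘₂₀ F.V g (A.tgt₁ α)) ∘₃₁ F.VR h (A.id₂ g ∘₂₀ α))
      ∘₃₂ (B.id₃ (B.id₂ (F.map h)) ∘₃₀ F.VR g α ∘₃₁ B.id₃ (F.V h (g ∘₁₀ A.src₁ α)))
  -- a vertical composite of two `2`-cells followed by a `1`-cell
  coh_VR_Y {a b c : A.Obj} (g : A.Hom b c) (β α : A.Cell₂ a b) (h : A.tgt₁ α = A.src₁ β) :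
    F.VR g (β ∘₂₁ α)
    = (F.VR g β ∘₃₁ B.id₃ (F.map₂ (A.id₂ g ∘₂₀ α)))
      ∘₃₂ (B.id₃ (B.id₂ (F.map g) ∘₂₀ F.map₂ β) ∘₃₁ F.VR g α)
  -- a `1`-cell followed by a vertical composite of two `2`-cells
  coh_VL_Y {a b c : A.Obj} (β α : A.Cell₂ b c) (f : A.Hom a b) (h : A.tgt₁ α = A.src₁ β) :
    F.VL (β ∘₂₁ α) f
    = (B.id₃ (F.map₂ β ∘₂₀ B.id₂ (F.map f)) ∘₃₁ F.VL α f)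
      ∘₃₂ (F.VL β f ∘₃₁ B.id₃ (F.map₂ (α ∘₂₀ A.id₂ f)))
  -- two `0`-composable `2`-cells
  coh_22 {a b c : A.Obj} (β : A.Cell₂ b c) (α : A.Cell₂ a b) :
    (B.id₃ (F.map₂ β ∘₂₀ B.id₂ (F.map (A.tgt₁ α))) ∘₃₁ F.VR (A.src₁ β) α)
      ∘₃₂ (B.id₃ (B.id₂ (F.map (A.tgt₁ β)) ∘₂₀ F.map₂ α) ∘₃₁ F.VL β (A.src₁ α))
    = (F.VL β (A.tgt₁ α) ∘₃₁ B.id₃ (F.map₂ (A.id₂ (A.src₁ β) ∘₂₀ α)))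
      ∘₃₂ (F.VR (A.tgt₁ β) α ∘₃₁ B.id₃ (F.map₂ (β ∘₂₀ A.id₂ (A.src₁ α))))
  -- three `1`-composable `2`-cells (an equality of identity `3`-cells)
  coh_YY {a b : A.Obj} (γ β α : A.Cell₂ a b)
      (h : A.tgt₁ α = A.src₁ β) (h' : A.tgt₁ β = A.src₁ γ) :
    B.id₃ (F.map₂ (γ ∘₂₁ β ∘₂₁ α)) ∘₃₂ (B.id₃ (F.map₂ γ) ∘₃₁ B.id₃ (F.map₂ (β ∘₂₁ α)))
    = B.id₃ (F.map₂ ((γ ∘₂₁ β) ∘₂₁ α)) ∘₃₂ (B.id₃ (F.map₂ (γ ∘₂₁ β)) ∘₃₁ B.id₃ (F.map₂ α))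
  -- `2`-composition of `3`-cells
  map₃_comp₃₂ {a b : A.Obj} (Δ Γ : A.Cell₃ a b) (h : A.tgt₂ Γ = A.src₂ Δ) :
    F.map₃ (Δ ∘₃₂ Γ) = F.map₃ Δ ∘₃₂ F.map₃ Γ
  -- `1`-composition of a `3`-cell with a `2`-cell, on either side
  map₃_whisker_right {a b : A.Obj} (Γ : A.Cell₃ a b) (α : A.Cell₂ a b)
      (h : A.tgt₁ α = A.src₁ (A.src₂ Γ)) :
    F.map₃ Γ ∘₃₁ B.id₃ (F.map₂ α) = F.map₃ (Γ ∘₃₁ A.id₃ α)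
  map₃_whisker_left {a b : A.Obj} (β : A.Cell₂ a b) (Γ : A.Cell₃ a b)
      (h : A.tgt₁ (A.src₂ Γ) = A.src₁ β) :
    B.id₃ (F.map₂ β) ∘₃₁ F.map₃ Γ = F.map₃ (A.id₃ β ∘₃₁ Γ)
  -- a `1`-cell followed by a `3`-cell
  coh_31 {a b c : A.Obj} (Γ : A.Cell₃ b c) (f : A.Hom a b) :
    F.VL (A.tgt₂ Γ) f
      ∘₃₂ (B.id₃ (F.V (A.tgt₁ (A.src₂ Γ)) f) ∘₃₁ F.map₃ (Γ ∘₃₀ A.id₃ (A.id₂ f)))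
    = (F.map₃ Γ ∘₃₀ B.id₃ (B.id₂ (F.map f)) ∘₃₁ B.id₃ (F.V (A.src₁ (A.src₂ Γ)) f))
      ∘₃₂ F.VL (A.src₂ Γ) f
  -- a `3`-cell followed by a `1`-cell
  coh_13 {a b c : A.Obj} (g : A.Hom b c) (Γ : A.Cell₃ a b) :
    (B.id₃ (F.V g (A.tgt₁ (A.src₂ Γ))) ∘₃₁ F.map₃ (A.id₃ (A.id₂ g) ∘₃₀ Γ))
      ∘₃₂ F.VR g (A.src₂ Γ)
    = F.VR g (A.tgt₂ Γ)
      ∘₃₂ (B.id₃ (B.id₂ (F.map g)) ∘₃₀ F.map₃ Γ ∘₃₁ B.id₃ (F.V g (A.src₁ (A.src₂ Γ))))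

/-- Normalised oplax `3`-functors. -/
structure NormalisedOplaxFunctor (A : ThreeCat.{u₁}) (B : ThreeCat.{u₂}) extends
    OplaxData A B where
  isNormalisedOplax : toOplaxData.IsNormalisedOplax

/-- The explicit data of the composite `GF` on the objects and `1`-cells of `A`. -/
def NormalisedOplaxFunctor.compData {A : ThreeCat.{u₁}} {B : ThreeCat.{u₂}} {C : ThreeCat.{u₃}}
    (G : NormalisedOplaxFunctor B C) (F : NormalisedOplaxFunctor A B) : OplaxData₁ A C where
  obj a := G.obj (F.obj a)
  map f := G.map (F.map f)
  V g f := G.V (F.map g) (F.map f) ∘₂₁ G.map₂ (F.V g f)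
  W h g f :=
    (C.id₃ (G.V (F.map h) (F.map g) ∘₂₀ C.id₂ (G.map (F.map f)))
        ∘₃₁ G.VL (F.V h g) (F.map f) ∘₃₁ C.id₃ (G.map₂ (F.V (h ∘₁₀ g) f)))
      ∘₃₂ (G.W (F.map h) (F.map g) (F.map f) ∘₃₁ G.map₃ (F.W h g f))
      ∘₃₂ (C.id₃ (C.id₂ (G.map (F.map h)) ∘₂₀ G.V (F.map g) (F.map f))
        ∘₃₁ G.VR (F.map h) (F.V g f) ∘₃₁ C.id₃ (G.map₂ (F.V h (g ∘₁₀ f))))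

/-
The structural `3`-cell of `GF` at three composable `1`-cells is the cell
`G(F(h), F(g), F(f)) ∗₁ G(F(h, g, f))`, precomposed with an instance of `VR G` and postcomposed with
an instance of `VL G`; these move the `2`-cells in the image of `F` past the structural `2`-cells
of `G`. By naturality of `VR G` and `VL G` and their compatibility with the `3`-cells `W G`, all
these instances can be moved to the two ends of either side of the coherence of `GF` for four
composable `1`-cells `f`, `g`, `h`, `i`. The same `3`-cells (`pushCell` and `pullCell`) then appear
at the ends of the two sides, and what remains in between is the coherence of `G` at `F(f)`, `F(g)`,
`F(h)`, `F(i)`, `1`-composed with the image under `G` of the coherence of `F` at `f`, `g`, `h`, `i`.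
If all `2`-cells and `3`-cells of the source are identities, the rest of the structure of an oplax
`3`-functor is determined by normalisation.
-/

namespace ThreeCat

variable {C : ThreeCat.{u}} {a b c d : C.Obj}

attribute [simp] src₁_id₂ tgt₁_id₂ src₂_id₃ tgt₂_id₃ src₁_comp₂₀ tgt₁_comp₂₀ src₂_comp₃₀
  tgt₂_comp₃₀ src₁_comp₂₁ tgt₁_comp₂₁ src₂_comp₃₁ tgt₂_comp₃₁ src₂_comp₃₂ tgt₂_comp₃₂
  assoc₁₀ assoc₂₀ id₂_comp₁₀ id_comp₁₀ comp₁₀_id id_comp₂₀ comp₂₀_id id₃_comp₂₁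

@[simp] lemma src₁_tgt₂ (Γ : C.Cell₃ a b) : C.src₁ (C.tgt₂ Γ) = C.src₁ (C.src₂ Γ) :=
  (C.src₁_src₂ Γ).symm

@[simp] lemma tgt₁_tgt₂ (Γ : C.Cell₃ a b) : C.tgt₁ (C.tgt₂ Γ) = C.tgt₁ (C.src₂ Γ) :=
  (C.tgt₁_src₂ Γ).symm

@[simp] lemma id₂_comp₂₁ (α : C.Cell₂ a b) {f : C.Hom a b} (h : C.tgt₁ α = f) :
    C.id₂ f ∘₂₁ α = α := h ▸ C.id_comp₂₁ α

@[simp] lemma comp₂₁_id₂ (α : C.Cell₂ a b) {f : C.Hom a b} (h : C.src₁ α = f) :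
    α ∘₂₁ C.id₂ f = α := h ▸ C.comp₂₁_id α

@[simp] lemma id₃_id₂_comp₃₁ (Γ : C.Cell₃ a b) {f : C.Hom a b} (h : C.tgt₁ (C.src₂ Γ) = f) :
    C.id₃ (C.id₂ f) ∘₃₁ Γ = Γ := h ▸ C.id_comp₃₁ Γ

@[simp] lemma comp₃₁_id₃_id₂ (Γ : C.Cell₃ a b) {f : C.Hom a b} (h : C.src₁ (C.src₂ Γ) = f) :
    Γ ∘₃₁ C.id₃ (C.id₂ f) = Γ := h ▸ C.comp₃₁_id Γ

@[simp] lemma id₃_comp₃₂ (Γ : C.Cell₃ a b) {α : C.Cell₂ a b} (h : C.tgt₂ Γ = α) :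
    C.id₃ α ∘₃₂ Γ = Γ := h ▸ C.id_comp₃₂ Γ

@[simp] lemma comp₃₂_id₃ (Γ : C.Cell₃ a b) {α : C.Cell₂ a b} (h : C.src₂ Γ = α) :
    Γ ∘₃₂ C.id₃ α = Γ := h ▸ C.comp₃₂_id Γ

@[simp] lemma id₂_comp₂₀_comp₂₁ (f : C.Hom b c) (β α : C.Cell₂ a b) (h : C.tgt₁ α = C.src₁ β) :
    C.id₂ f ∘₂₀ (β ∘₂₁ α) = C.id₂ f ∘₂₀ β ∘₂₁ C.id₂ f ∘₂₀ α := by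
  simp [← C.interchange₂, h]

@[simp] lemma id₃_id₂_comp₃₀_comp₃₁ (f : C.Hom b c) (Δ Γ : C.Cell₃ a b)
    (h : C.tgt₁ (C.src₂ Γ) = C.src₁ (C.src₂ Δ)) :
    C.id₃ (C.id₂ f) ∘₃₀ (Δ ∘₃₁ Γ) = C.id₃ (C.id₂ f) ∘₃₀ Δ ∘₃₁ C.id₃ (C.id₂ f) ∘₃₀ Γ := by
  simp [← C.interchange₃₀₁, h]

@[simp] lemma id₃_id₂_comp₃₀_comp₃₂ (f : C.Hom b c) (Δ Γ : C.Cell₃ a b) (h : C.tgt₂ Γ = C.src₂ Δ) :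
    C.id₃ (C.id₂ f) ∘₃₀ (Δ ∘₃₂ Γ) = C.id₃ (C.id₂ f) ∘₃₀ Δ ∘₃₂ C.id₃ (C.id₂ f) ∘₃₀ Γ := by
  simp [← C.interchange₃₀₂, h]

lemma exchange₂ (β : C.Cell₂ b c) (α : C.Cell₂ a b) :
    C.id₂ (C.tgt₁ β) ∘₂₀ α ∘₂₁ β ∘₂₀ C.id₂ (C.src₁ α)
      = β ∘₂₀ C.id₂ (C.tgt₁ α) ∘₂₁ C.id₂ (C.src₁ β) ∘₂₀ α := by
  simp [← C.interchange₂]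

lemma exchange₂_assoc (β : C.Cell₂ b c) (α : C.Cell₂ a b) (γ : C.Cell₂ a c)
    (h : C.tgt₁ γ = C.src₁ β ∘₁₀ C.src₁ α) :
    β ∘₂₀ C.id₂ (C.tgt₁ α) ∘₂₁ C.id₂ (C.src₁ β) ∘₂₀ α ∘₂₁ γ
      = C.id₂ (C.tgt₁ β) ∘₂₀ α ∘₂₁ β ∘₂₀ C.id₂ (C.src₁ α) ∘₂₁ γ := by
  rw [← C.assoc₂₁ _ _ _ (by simp [h]) (by simp), ← C.assoc₂₁ _ _ _ (by simp [h]) (by simp),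
    exchange₂]

lemma id₃_exchange₂_assoc (β : C.Cell₂ b c) (α : C.Cell₂ a b) (Γ : C.Cell₃ a c)
    (h : C.tgt₁ (C.src₂ Γ) = C.src₁ β ∘₁₀ C.src₁ α) :
    C.id₃ (β ∘₂₀ C.id₂ (C.tgt₁ α)) ∘₃₁ C.id₃ (C.id₂ (C.src₁ β) ∘₂₀ α) ∘₃₁ Γ
      = C.id₃ (C.id₂ (C.tgt₁ β) ∘₂₀ α) ∘₃₁ C.id₃ (β ∘₂₀ C.id₂ (C.src₁ α)) ∘₃₁ Γ := by
  rw [← C.assoc₃₁ _ _ _ (by simp [h]) (by simp), ← C.assoc₃₁ _ _ _ (by simp [h]) (by simp),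
    ← C.id₃_comp₂₁ _ _ (by simp), ← C.id₃_comp₂₁ _ _ (by simp), exchange₂]

@[simp] lemma comp₂₁_comp₂₀_id₂ (β α : C.Cell₂ b c) (f : C.Hom a b) (h : C.tgt₁ α = C.src₁ β) :
    (β ∘₂₁ α) ∘₂₀ C.id₂ f = β ∘₂₀ C.id₂ f ∘₂₁ α ∘₂₀ C.id₂ f := by
  simp [← C.interchange₂, h]

@[simp] lemma comp₃₁_comp₃₀_id₃_id₂ (Δ Γ : C.Cell₃ b c) (f : C.Hom a b)
    (h : C.tgt₁ (C.src₂ Γ) = C.src₁ (C.src₂ Δ)) :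
    (Δ ∘₃₁ Γ) ∘₃₀ C.id₃ (C.id₂ f) = Δ ∘₃₀ C.id₃ (C.id₂ f) ∘₃₁ Γ ∘₃₀ C.id₃ (C.id₂ f) := by
  simp [← C.interchange₃₀₁, h]

@[simp] lemma comp₃₂_comp₃₀_id₃_id₂ (Δ Γ : C.Cell₃ b c) (f : C.Hom a b) (h : C.tgt₂ Γ = C.src₂ Δ) :
    (Δ ∘₃₂ Γ) ∘₃₀ C.id₃ (C.id₂ f) = Δ ∘₃₀ C.id₃ (C.id₂ f) ∘₃₂ Γ ∘₃₀ C.id₃ (C.id₂ f) := by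
  simp [← C.interchange₃₀₂, h]

@[simp] lemma id₃_comp₃₀_id₃ (β : C.Cell₂ b c) (α : C.Cell₂ a b) :
    C.id₃ β ∘₃₀ C.id₃ α = C.id₃ (β ∘₂₀ α) := (C.id₃_comp₂₀ β α).symm

lemma comp₃₁_comp₃₂ (Γ Δ' Δ : C.Cell₃ a b) (hΔ : C.tgt₂ Δ = C.src₂ Δ')
    (h : C.tgt₁ (C.src₂ Δ) = C.src₁ (C.src₂ Γ)) :
    Γ ∘₃₁ (Δ' ∘₃₂ Δ) = (Γ ∘₃₁ Δ') ∘₃₂ (C.id₃ (C.src₂ Γ) ∘₃₁ Δ) := by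
  simp [← C.interchange₃₁₂, hΔ, h]

lemma comp₃₁_comp₃₂' (Γ Δ' Δ : C.Cell₃ a b) (hΔ : C.tgt₂ Δ = C.src₂ Δ')
    (h : C.tgt₁ (C.src₂ Δ) = C.src₁ (C.src₂ Γ)) :
    Γ ∘₃₁ (Δ' ∘₃₂ Δ) = (C.id₃ (C.tgt₂ Γ) ∘₃₁ Δ') ∘₃₂ (Γ ∘₃₁ Δ) := by
  simp [← C.interchange₃₁₂, hΔ, h]

lemma comp₃₂_comp₃₁ (Δ' Δ Γ : C.Cell₃ a b) (hΔ : C.tgt₂ Δ = C.src₂ Δ')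
    (h : C.tgt₁ (C.src₂ Γ) = C.src₁ (C.src₂ Δ)) :
    (Δ' ∘₃₂ Δ) ∘₃₁ Γ = (Δ' ∘₃₁ C.id₃ (C.tgt₂ Γ)) ∘₃₂ (Δ ∘₃₁ Γ) := by
  simp [← C.interchange₃₁₂, hΔ, h]

lemma comp₃₂_comp₃₁' (Δ' Δ Γ : C.Cell₃ a b) (hΔ : C.tgt₂ Δ = C.src₂ Δ')
    (h : C.tgt₁ (C.src₂ Γ) = C.src₁ (C.src₂ Δ)) :
    (Δ' ∘₃₂ Δ) ∘₃₁ Γ = (Δ' ∘₃₁ Γ) ∘₃₂ (Δ ∘₃₁ C.id₃ (C.src₂ Γ)) := by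
  simp [← C.interchange₃₁₂, hΔ, h]

@[simp] lemma id₃_comp₃₁_comp₃₂ (β : C.Cell₂ a b) (Δ Γ : C.Cell₃ a b) (hΔ : C.tgt₂ Γ = C.src₂ Δ)
    (h : C.tgt₁ (C.src₂ Γ) = C.src₁ β) :
    C.id₃ β ∘₃₁ (Δ ∘₃₂ Γ) = (C.id₃ β ∘₃₁ Δ) ∘₃₂ (C.id₃ β ∘₃₁ Γ) := by
  simp [comp₃₁_comp₃₂, hΔ, h]

@[simp] lemma comp₃₂_comp₃₁_id₃ (Δ Γ : C.Cell₃ a b) (α : C.Cell₂ a b) (hΔ : C.tgt₂ Γ = C.src₂ Δ)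
    (h : C.tgt₁ α = C.src₁ (C.src₂ Γ)) :
    (Δ ∘₃₂ Γ) ∘₃₁ C.id₃ α = (Δ ∘₃₁ C.id₃ α) ∘₃₂ (Γ ∘₃₁ C.id₃ α) := by
  simp [comp₃₂_comp₃₁, hΔ, h]

@[simp] lemma comp₃₂_comp₃₁_id₃_comp₃₁_id₃ (Δ Γ : C.Cell₃ a b) (β α : C.Cell₂ a b)
    (hΔ : C.tgt₂ Γ = C.src₂ Δ) (hβ : C.tgt₁ β = C.src₁ (C.src₂ Γ)) (hα : C.tgt₁ α = C.src₁ β) :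
    (Δ ∘₃₂ Γ) ∘₃₁ (C.id₃ β ∘₃₁ C.id₃ α)
      = (Δ ∘₃₁ C.id₃ β ∘₃₁ C.id₃ α) ∘₃₂ (Γ ∘₃₁ C.id₃ β ∘₃₁ C.id₃ α) := by
  rw [← C.id₃_comp₂₁ β α hα, comp₃₂_comp₃₁_id₃ Δ Γ _ hΔ (by simp [hα, hβ])]

lemma exchange₃ (Γ Δ : C.Cell₃ a b) (h : C.tgt₁ (C.src₂ Δ) = C.src₁ (C.src₂ Γ)) :
    (Γ ∘₃₁ C.id₃ (C.tgt₂ Δ)) ∘₃₂ (C.id₃ (C.src₂ Γ) ∘₃₁ Δ)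
      = (C.id₃ (C.tgt₂ Γ) ∘₃₁ Δ) ∘₃₂ (Γ ∘₃₁ C.id₃ (C.src₂ Δ)) := by
  simp [← C.interchange₃₁₂, h]

end ThreeCat

namespace NormalisedOplaxFunctor

open ThreeCat

variable {A : ThreeCat.{u₁}} {B : ThreeCat.{u₂}} {C : ThreeCat.{u₃}}

section

variable (F : NormalisedOplaxFunctor A B) {a b c d : A.Obj}

@[simp] lemma src_V (g : A.Hom b c) (f : A.Hom a b) :
    B.src₁ (F.V g f) = F.map (g ∘₁₀ f) := F.isNormalisedOplax.src_V g f

@[simp] lemma tgt_V (g : A.Hom b c) (f : A.Hom a b) :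
    B.tgt₁ (F.V g f) = F.map g ∘₁₀ F.map f := F.isNormalisedOplax.tgt_V g f

@[simp] lemma src_map₂ (α : A.Cell₂ a b) : B.src₁ (F.map₂ α) = F.map (A.src₁ α) :=
  F.isNormalisedOplax.src_map₂ α

@[simp] lemma tgt_map₂ (α : A.Cell₂ a b) : B.tgt₁ (F.map₂ α) = F.map (A.tgt₁ α) :=
  F.isNormalisedOplax.tgt_map₂ α

@[simp] lemma src_W (h : A.Hom c d) (g : A.Hom b c) (f : A.Hom a b) :
    B.src₂ (F.W h g f) = B.id₂ (F.map h) ∘₂₀ F.V g f ∘₂₁ F.V h (g ∘₁₀ f) :=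
  F.isNormalisedOplax.src_W h g f

@[simp] lemma tgt_W (h : A.Hom c d) (g : A.Hom b c) (f : A.Hom a b) :
    B.tgt₂ (F.W h g f) = F.V h g ∘₂₀ B.id₂ (F.map f) ∘₂₁ F.V (h ∘₁₀ g) f :=
  F.isNormalisedOplax.tgt_W h g f

@[simp] lemma src_VR (g : A.Hom b c) (α : A.Cell₂ a b) :
    B.src₂ (F.VR g α) = B.id₂ (F.map g) ∘₂₀ F.map₂ α ∘₂₁ F.V g (A.src₁ α) :=
  F.isNormalisedOplax.src_VR g α

@[simp] lemma tgt_VR (g : A.Hom b c) (α : A.Cell₂ a b) :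
    B.tgt₂ (F.VR g α) = F.V g (A.tgt₁ α) ∘₂₁ F.map₂ (A.id₂ g ∘₂₀ α) :=
  F.isNormalisedOplax.tgt_VR g α

@[simp] lemma src_VL (β : A.Cell₂ b c) (f : A.Hom a b) :
    B.src₂ (F.VL β f) = F.V (A.tgt₁ β) f ∘₂₁ F.map₂ (β ∘₂₀ A.id₂ f) :=
  F.isNormalisedOplax.src_VL β f

@[simp] lemma tgt_VL (β : A.Cell₂ b c) (f : A.Hom a b) :
    B.tgt₂ (F.VL β f) = F.map₂ β ∘₂₀ B.id₂ (F.map f) ∘₂₁ F.V (A.src₁ β) f :=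
  F.isNormalisedOplax.tgt_VL β f

@[simp] lemma src_map₃ (Γ : A.Cell₃ a b) : B.src₂ (F.map₃ Γ) = F.map₂ (A.src₂ Γ) :=
  F.isNormalisedOplax.src_map₃ Γ

@[simp] lemma tgt_map₃ (Γ : A.Cell₃ a b) : B.tgt₂ (F.map₃ Γ) = F.map₂ (A.tgt₂ Γ) :=
  F.isNormalisedOplax.tgt_map₃ Γ

@[simp] lemma map₂_comp₂₁ (β α : A.Cell₂ a b) (h : A.tgt₁ α = A.src₁ β) :
    F.map₂ (β ∘₂₁ α) = F.map₂ β ∘₂₁ F.map₂ α := (F.isNormalisedOplax.coh_Y β α h).symm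

@[simp] lemma map₃_comp₃₂ (Δ Γ : A.Cell₃ a b) (h : A.tgt₂ Γ = A.src₂ Δ) :
    F.map₃ (Δ ∘₃₂ Γ) = F.map₃ Δ ∘₃₂ F.map₃ Γ := F.isNormalisedOplax.map₃_comp₃₂ Δ Γ h

@[simp] lemma map₃_comp₃₁_id₃ (Γ : A.Cell₃ a b) (α : A.Cell₂ a b)
    (h : A.tgt₁ α = A.src₁ (A.src₂ Γ)) :
    F.map₃ (Γ ∘₃₁ A.id₃ α) = F.map₃ Γ ∘₃₁ B.id₃ (F.map₂ α) :=
  (F.isNormalisedOplax.map₃_whisker_right Γ α h).symm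

@[simp] lemma map₃_id₃_comp₃₁ (β : A.Cell₂ a b) (Γ : A.Cell₃ a b)
    (h : A.tgt₁ (A.src₂ Γ) = A.src₁ β) :
    F.map₃ (A.id₃ β ∘₃₁ Γ) = B.id₃ (F.map₂ β) ∘₃₁ F.map₃ Γ :=
  (F.isNormalisedOplax.map₃_whisker_left β Γ h).symm

end

end NormalisedOplaxFunctor

local notation:80 f:81 " ◁₂ " α:80 => ThreeCat.comp₂₀ _ (ThreeCat.id₂ _ f) α
local notation:81 α:81 " ▷₂ " f:82 => ThreeCat.comp₂₀ _ α (ThreeCat.id₂ _ f)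
local notation:80 f:81 " ◁₃ " Γ:80 => ThreeCat.comp₃₀ _ (ThreeCat.id₃ _ (ThreeCat.id₂ _ f)) Γ
local notation:81 Γ:81 " ▷₃ " f:82 => ThreeCat.comp₃₀ _ Γ (ThreeCat.id₃ _ (ThreeCat.id₂ _ f))
local notation:75 β:76 " ◃ " Γ:75 => ThreeCat.comp₃₁ _ (ThreeCat.id₃ _ β) Γ
local notation:75 Γ:76 " ▹ " α:76 => ThreeCat.comp₃₁ _ Γ (ThreeCat.id₃ _ α)

namespace ThreeCat

variable {C : ThreeCat.{u}} {a b : C.Obj}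

lemma comp₃₂_paste_two {p q r p' q' r' s t u v s' t' m m' : C.Cell₃ a b}
    (hst : r ∘₃₂ p' = s ∘₃₂ t) (hs : p ∘₃₂ q ∘₃₂ s = u ∘₃₂ s' ∘₃₂ m)
    (ht : t ∘₃₂ q' ∘₃₂ r' = m' ∘₃₂ t' ∘₃₂ v)
    (h₁ : C.tgt₂ q = C.src₂ p) (h₂ : C.tgt₂ r = C.src₂ q) (h₃ : C.tgt₂ p' = C.src₂ r)
    (h₄ : C.tgt₂ q' = C.src₂ p') (h₅ : C.tgt₂ r' = C.src₂ q') (h₆ : C.tgt₂ t = C.src₂ s)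
    (h₇ : C.tgt₂ s' = C.src₂ u) (h₈ : C.tgt₂ m = C.src₂ s') :
    (p ∘₃₂ q ∘₃₂ r) ∘₃₂ (p' ∘₃₂ q' ∘₃₂ r')
      = (u ∘₃₂ s') ∘₃₂ m ∘₃₂ m' ∘₃₂ (t' ∘₃₂ v) := by
  have hsrc := congrArg C.src₂ hst
  have htgt := congrArg C.tgt₂ hst
  have hm := congrArg C.src₂ hs
  have hm' := congrArg C.tgt₂ ht
  calc
    (p ∘₃₂ q ∘₃₂ r) ∘₃₂ (p' ∘₃₂ q' ∘₃₂ r') = p ∘₃₂ q ∘₃₂ (r ∘₃₂ p') ∘₃₂ q' ∘₃₂ r' := by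
      grind [ThreeCat.assoc₃₂, src₂_comp₃₂, tgt₂_comp₃₂]
    _ = (p ∘₃₂ q ∘₃₂ s) ∘₃₂ (t ∘₃₂ q' ∘₃₂ r') := by
      grind [ThreeCat.assoc₃₂, src₂_comp₃₂, tgt₂_comp₃₂]
    _ = (u ∘₃₂ s') ∘₃₂ m ∘₃₂ m' ∘₃₂ (t' ∘₃₂ v) := by
      grind [ThreeCat.assoc₃₂, src₂_comp₃₂, tgt₂_comp₃₂]

lemma comp₃₂_paste_three
    {p q r p' q' r' p'' q'' r'' s t s' t' m m' m'' : C.Cell₃ a b}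
    (hm : r ∘₃₂ p' ∘₃₂ q' ∘₃₂ r' ∘₃₂ p'' = s ∘₃₂ m' ∘₃₂ t) (hs : q ∘₃₂ s = s' ∘₃₂ m)
    (ht : t ∘₃₂ q'' = m'' ∘₃₂ t')
    (h₁ : C.tgt₂ q = C.src₂ p) (h₂ : C.tgt₂ r = C.src₂ q) (h₃ : C.tgt₂ p' = C.src₂ r)
    (h₄ : C.tgt₂ q' = C.src₂ p') (h₅ : C.tgt₂ r' = C.src₂ q') (h₆ : C.tgt₂ p'' = C.src₂ r')
    (h₇ : C.tgt₂ q'' = C.src₂ p'') (h₈ : C.tgt₂ r'' = C.src₂ q'')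
    (h₉ : C.tgt₂ m' = C.src₂ s) (h₁₀ : C.tgt₂ t = C.src₂ m')
    (h₁₁ : C.tgt₂ m = C.src₂ s') (h₁₂ : C.tgt₂ t' = C.src₂ m'') :
    (p ∘₃₂ q ∘₃₂ r) ∘₃₂ (p' ∘₃₂ q' ∘₃₂ r') ∘₃₂ (p'' ∘₃₂ q'' ∘₃₂ r'')
      = (p ∘₃₂ s') ∘₃₂ m ∘₃₂ m' ∘₃₂ m'' ∘₃₂ (t' ∘₃₂ r'') := by
  have hm₁ := congrArg C.src₂ hm
  have hm₂ := congrArg C.tgt₂ hm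
  have hs₁ := congrArg C.src₂ hs
  have ht₂ := congrArg C.tgt₂ ht
  calc
    (p ∘₃₂ q ∘₃₂ r) ∘₃₂ (p' ∘₃₂ q' ∘₃₂ r') ∘₃₂ (p'' ∘₃₂ q'' ∘₃₂ r'')
        = p ∘₃₂ q ∘₃₂ (r ∘₃₂ p' ∘₃₂ q' ∘₃₂ r' ∘₃₂ p'') ∘₃₂ q'' ∘₃₂ r'' := by
      grind [ThreeCat.assoc₃₂, src₂_comp₃₂, tgt₂_comp₃₂]
    _ = p ∘₃₂ (q ∘₃₂ s) ∘₃₂ m' ∘₃₂ (t ∘₃₂ q'') ∘₃₂ r'' := by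
      grind [ThreeCat.assoc₃₂, src₂_comp₃₂, tgt₂_comp₃₂]
    _ = (p ∘₃₂ s') ∘₃₂ m ∘₃₂ m' ∘₃₂ m'' ∘₃₂ (t' ∘₃₂ r'') := by
      grind [ThreeCat.assoc₃₂, src₂_comp₃₂, tgt₂_comp₃₂]

end ThreeCat

namespace NormalisedOplaxFunctor

open ThreeCat

variable {A : ThreeCat.{u₁}} {B : ThreeCat.{u₂}} {C : ThreeCat.{u₃}}

section

variable (G : NormalisedOplaxFunctor B C) {a b c d : B.Obj}

lemma coh_13_comp₃₁ (g : B.Hom b c) (θ : B.Cell₃ a b)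
    (w : C.Cell₃ (G.obj a) (G.obj b))
    (h : C.src₁ (C.src₂ w) = G.map (B.tgt₁ (B.src₂ θ))) :
    (G.map g ◁₃ w ∘₃₁ G.V g (B.tgt₁ (B.src₂ θ)) ◃ G.map₃ (g ◁₃ θ))
        ∘₃₂ (G.map g ◁₂ C.src₂ w ◃ G.VR g (B.src₂ θ))
      = (G.map g ◁₂ C.tgt₂ w ◃ G.VR g (B.tgt₂ θ))
        ∘₃₂ (G.map g ◁₃ w ∘₃₁ G.map g ◁₃ G.map₃ θ ▹ G.V g (B.src₁ (B.src₂ θ))) := by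
  have h₁ := comp₃₁_comp₃₂ (G.map g ◁₃ w) (G.V g (B.tgt₁ (B.src₂ θ)) ◃ G.map₃ (g ◁₃ θ))
    (G.VR g (B.src₂ θ)) (by simp) (by simp [h])
  have h₂ := comp₃₁_comp₃₂' (G.map g ◁₃ w) (G.VR g (B.tgt₂ θ))
    (G.map g ◁₃ G.map₃ θ ▹ G.V g (B.src₁ (B.src₂ θ))) (by simp) (by simp [h])
  simpa only [G.isNormalisedOplax.coh_13 g θ, src₂_comp₃₀, tgt₂_comp₃₀, src₂_id₃, tgt₂_id₃]
    using h₁.symm.trans ((congrArg _ (G.isNormalisedOplax.coh_13 g θ)).trans h₂)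

lemma coh_31_comp₃₁ (θ : B.Cell₃ b c) (f : B.Hom a b) (w : C.Cell₃ (G.obj b) (G.obj c))
    (h : C.src₁ (C.src₂ w) = G.map (B.tgt₁ (B.src₂ θ))) :
    (C.tgt₂ w ▷₂ G.map f ◃ G.VL (B.tgt₂ θ) f)
        ∘₃₂ (w ▷₃ G.map f ∘₃₁ G.V (B.tgt₁ (B.src₂ θ)) f ◃ G.map₃ (θ ▷₃ f))
      = (w ▷₃ G.map f ∘₃₁ G.map₃ θ ▷₃ G.map f ▹ G.V (B.src₁ (B.src₂ θ)) f)
        ∘₃₂ (C.src₂ w ▷₂ G.map f ◃ G.VL (B.src₂ θ) f) := by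
  have h₁ := comp₃₁_comp₃₂' (w ▷₃ G.map f) (G.VL (B.tgt₂ θ) f)
    (G.V (B.tgt₁ (B.src₂ θ)) f ◃ G.map₃ (θ ▷₃ f)) (by simp) (by simp [h])
  have h₂ := comp₃₁_comp₃₂ (w ▷₃ G.map f) (G.map₃ θ ▷₃ G.map f ▹ G.V (B.src₁ (B.src₂ θ)) f)
    (G.VL (B.src₂ θ) f) (by simp) (by simp [h])
  simpa only [src₂_comp₃₀, tgt₂_comp₃₀, src₂_id₃, tgt₂_id₃]
    using h₁.symm.trans ((congrArg _ (G.isNormalisedOplax.coh_31 θ f)).trans h₂)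

lemma whisker_VR_comp₂₁ (p : C.Cell₂ (G.obj a) (G.obj c)) (g : B.Hom b c) (β α : B.Cell₂ a b)
    (φ φ' : B.Cell₂ a c) (h : B.tgt₁ α = B.src₁ β) (hφ : B.tgt₁ φ = g ∘₁₀ B.src₁ α)
    (hφ' : φ' = g ◁₂ α ∘₂₁ φ) (hp : C.src₁ p = G.map g ∘₁₀ G.map (B.tgt₁ β)) :
    (p ◃ G.VR g β ▹ G.map₂ φ') ∘₃₂ (p ◃ G.map g ◁₂ G.map₂ β ◃ G.VR g α ▹ G.map₂ φ)
      = p ◃ G.VR g (β ∘₂₁ α) ▹ G.map₂ φ := by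
  -- Each boundary condition of an iterated composite refers to boundaries of smaller composites,
  -- so their simplification nests deeper than the default discharge depth allows.
  simp (maxDischargeDepth := 8) [G.isNormalisedOplax.coh_VR_Y, C.assoc₂₁, C.assoc₃₁, h, hφ, hφ', hp]

lemma whisker_VL_comp₂₁ (p : C.Cell₂ (G.obj a) (G.obj c)) (β α : B.Cell₂ b c) (f : B.Hom a b)
    (ω ω' : B.Cell₂ a c) (h : B.tgt₁ α = B.src₁ β) (hω : B.tgt₁ ω = B.src₁ α ∘₁₀ f)
    (hω' : ω' = α ▷₂ f ∘₂₁ ω) (hp : C.src₁ p = G.map (B.tgt₁ β) ∘₁₀ G.map f) :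
    (p ◃ G.map₂ β ▷₂ G.map f ◃ G.VL α f ▹ G.map₂ ω) ∘₃₂ (p ◃ G.VL β f ▹ G.map₂ ω')
      = p ◃ G.VL (β ∘₂₁ α) f ▹ G.map₂ ω := by
  simp (maxDischargeDepth := 8) [G.isNormalisedOplax.coh_VL_Y, C.assoc₂₁, C.assoc₃₁, h, hω, hω', hp]

lemma coh_112_comp₃₁_map₃ (i : B.Hom c d) (h : B.Hom b c) (σ : B.Cell₂ a b) (χ : B.Cell₂ a c)
    (φ : B.Cell₂ a d) (Γ : B.Cell₃ a d) (hχ : B.tgt₁ χ = h ∘₁₀ B.src₁ σ)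
    (hφ : B.tgt₁ φ = i ∘₁₀ B.src₁ χ) (hΓ : B.src₂ Γ = i ◁₂ χ ∘₂₁ φ) :
    (G.V i h ▷₂ G.map (B.tgt₁ σ) ◃ G.VR (i ∘₁₀ h) σ ▹ G.map₂ (B.tgt₂ Γ))
      ∘₃₂ (G.map i ◁₂ G.map h ◁₂ G.map₂ σ ◃ G.W i h (B.src₁ σ) ∘₃₁ G.map₃ Γ)
      ∘₃₂ (G.map i ◁₂ G.map h ◁₂ G.map₂ σ ◃ G.map i ◁₂ G.V h (B.src₁ σ) ◃ G.VR i χ ▹ G.map₂ φ)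
    = (G.W i h (B.tgt₁ σ) ∘₃₁ G.map₂ (i ◁₂ h ◁₂ σ) ◃ G.map₃ Γ)
      ∘₃₂ (G.map i ◁₂ G.V h (B.tgt₁ σ) ◃ G.VR i (h ◁₂ σ ∘₂₁ χ) ▹ G.map₂ φ)
      ∘₃₂ (G.map i ◁₃ G.VR h σ ∘₃₁ C.id₃ (G.map i ◁₂ G.map₂ χ) ∘₃₁ C.id₃ (G.V i (B.src₁ χ))
        ▹ G.map₂ φ) := by
  have hx := exchange₂_assoc (G.V i h) (G.map₂ σ)
  simp only [src_V, tgt_V, src_map₂, tgt_map₂, id₂_comp₁₀, assoc₂₀] at hx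
  have hcoh : (G.V i h ▷₂ G.map (B.tgt₁ σ) ◃ G.VR (i ∘₁₀ h) σ ▹ G.map₂ (B.tgt₂ Γ))
      ∘₃₂ (G.map i ◁₂ G.map h ◁₂ G.map₂ σ ◃ G.W i h (B.src₁ σ) ∘₃₁ G.map₃ Γ)
      = (G.W i h (B.tgt₁ σ) ∘₃₁ G.map₂ (i ◁₂ h ◁₂ σ) ◃ G.map₃ Γ)
      ∘₃₂ (G.map i ◁₂ G.V h (B.tgt₁ σ) ◃ G.VR i (h ◁₂ σ) ▹ G.map₂ (B.src₂ Γ))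
      ∘₃₂ (G.map i ◁₃ G.VR h σ ∘₃₁ G.V i (h ∘₁₀ B.src₁ σ) ◃ C.id₃ (G.map₂ (B.src₂ Γ))) := by
    have h₁ := congrArg (fun Θ => Θ ∘₃₁ G.map₃ Γ) (G.isNormalisedOplax.coh_112 i h σ)
    beta_reduce at h₁
    rw [comp₃₂_comp₃₁, comp₃₂_comp₃₁', comp₃₂_comp₃₁'] at h₁
    · simpa (maxDischargeDepth := 8) [C.assoc₃₁, C.assoc₂₁, hΓ, hχ, hφ] using h₁
    all_goals simp (maxDischargeDepth := 8) [C.assoc₂₁, hΓ, hχ, hφ, hx]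
  have hVR : (G.map i ◁₃ G.VR h σ ∘₃₁ G.V i (h ∘₁₀ B.src₁ σ) ◃ C.id₃ (G.map₂ (B.src₂ Γ)))
      ∘₃₂ (G.map i ◁₂ G.map h ◁₂ G.map₂ σ ◃ G.map i ◁₂ G.V h (B.src₁ σ) ◃ G.VR i χ ▹ G.map₂ φ)
      = (G.map i ◁₂ G.V h (B.tgt₁ σ) ◃ G.map i ◁₂ G.map₂ (h ◁₂ σ) ◃ G.VR i χ ▹ G.map₂ φ)
      ∘₃₂ (G.map i ◁₃ G.VR h σ ∘₃₁ G.map i ◁₂ G.map₂ χ ◃ G.V i (B.src₁ χ) ◃ C.id₃ (G.map₂ φ)) := by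
    simpa (maxDischargeDepth := 8) [C.assoc₃₁, hΓ, hχ, hφ] using exchange₃
      (G.map i ◁₃ G.VR h σ) (G.VR i χ ▹ G.map₂ φ)
      (by simp (maxDischargeDepth := 8) [hχ, hφ])
  rw [← whisker_VR_comp₂₁ G _ _ _ _ _ (B.src₂ Γ), ← C.assoc₃₂, hcoh, C.assoc₃₂, C.assoc₃₂, hVR,
    C.assoc₃₂]
  all_goals simp (maxDischargeDepth := 8) [C.assoc₂₁, hΓ, hχ, hφ, hx]

lemma coh_211_comp₃₁_map₃ (ρ : B.Cell₂ c d) (g : B.Hom b c) (f : B.Hom a b) (χ : B.Cell₂ b d)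
    (ω : B.Cell₂ a d) (Γ : B.Cell₃ a d) (hχ : B.tgt₁ χ = B.src₁ ρ ∘₁₀ g)
    (hω : B.tgt₁ ω = B.src₁ χ ∘₁₀ f) (hΓ : B.tgt₂ Γ = χ ▷₂ f ∘₂₁ ω) :
    (G.map₂ ρ ▷₂ G.map g ▷₂ G.map f ◃ G.V (B.src₁ ρ) g ▷₂ G.map f ◃ G.VL χ f ▹ G.map₂ ω)
      ∘₃₂ (G.map₂ ρ ▷₂ G.map g ▷₂ G.map f ◃ G.W (B.src₁ ρ) g f ∘₃₁ G.map₃ Γ)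
      ∘₃₂ (G.map (B.tgt₁ ρ) ◁₂ G.V g f ◃ G.VL ρ (g ∘₁₀ f) ▹ G.map₂ (B.src₂ Γ))
    = (G.VL ρ g ▷₃ G.map f ∘₃₁ G.map₂ χ ▷₂ G.map f ◃ G.V (B.src₁ χ) f ◃ C.id₃ (G.map₂ ω))
      ∘₃₂ (G.V (B.tgt₁ ρ) g ▷₂ G.map f ◃ G.VL (ρ ▷₂ g ∘₂₁ χ) f ▹ G.map₂ ω)
      ∘₃₂ (G.W (B.tgt₁ ρ) g f ∘₃₁ G.map₂ (ρ ▷₂ g ▷₂ f) ◃ G.map₃ Γ) := by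
  have hx := exchange₂_assoc (G.map₂ ρ) (G.V g f)
  simp only [src_V, tgt_V, src_map₂, tgt_map₂, id₂_comp₁₀] at hx
  have hΓ₁ : B.tgt₁ (B.src₂ Γ) = B.src₁ ρ ∘₁₀ g ∘₁₀ f := by
    simpa (maxDischargeDepth := 8) [hω, hχ] using congrArg B.tgt₁ hΓ
  have hcoh : (G.map₂ ρ ▷₂ G.map g ▷₂ G.map f ◃ G.W (B.src₁ ρ) g f ∘₃₁ G.map₃ Γ)
      ∘₃₂ (G.map (B.tgt₁ ρ) ◁₂ G.V g f ◃ G.VL ρ (g ∘₁₀ f) ▹ G.map₂ (B.src₂ Γ))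
      = (G.VL ρ g ▷₃ G.map f ∘₃₁ G.V (B.src₁ ρ ∘₁₀ g) f ◃ C.id₃ (G.map₂ (B.tgt₂ Γ)))
      ∘₃₂ (G.V (B.tgt₁ ρ) g ▷₂ G.map f ◃ G.VL (ρ ▷₂ g) f ▹ G.map₂ (B.tgt₂ Γ))
      ∘₃₂ (G.W (B.tgt₁ ρ) g f ∘₃₁ G.map₂ (ρ ▷₂ g ▷₂ f) ◃ G.map₃ Γ) := by
    have h₁ := congrArg (fun Θ => Θ ∘₃₁ G.map₃ Γ) (G.isNormalisedOplax.coh_211 ρ g f)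
    beta_reduce at h₁
    rw [comp₃₂_comp₃₁', comp₃₂_comp₃₁, comp₃₂_comp₃₁] at h₁
    · simpa (maxDischargeDepth := 8) [C.assoc₃₁, C.assoc₂₁, hΓ, hχ, hω, hΓ₁] using h₁
    all_goals simp (maxDischargeDepth := 8) [C.assoc₂₁, hΓ₁, hx]
  have hVL : (G.map₂ ρ ▷₂ G.map g ▷₂ G.map f ◃ G.V (B.src₁ ρ) g ▷₂ G.map f ◃ G.VL χ f ▹ G.map₂ ω)
      ∘₃₂ (G.VL ρ g ▷₃ G.map f ∘₃₁ G.V (B.src₁ ρ ∘₁₀ g) f ◃ C.id₃ (G.map₂ (B.tgt₂ Γ)))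
      = (G.VL ρ g ▷₃ G.map f ∘₃₁ G.map₂ χ ▷₂ G.map f ◃ G.V (B.src₁ χ) f ◃ C.id₃ (G.map₂ ω))
      ∘₃₂ (G.V (B.tgt₁ ρ) g ▷₂ G.map f ◃ G.map₂ (ρ ▷₂ g) ▷₂ G.map f ◃ G.VL χ f ▹ G.map₂ ω) := by
    simpa (maxDischargeDepth := 8) [C.assoc₃₁, hΓ, hχ, hω] using (exchange₃
      (G.VL ρ g ▷₃ G.map f) (G.VL χ f ▹ G.map₂ ω)
      (by simp (maxDischargeDepth := 8) [hχ, hω])).symm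
  rw [← whisker_VL_comp₂₁ G _ _ _ _ _ (B.tgt₂ Γ), hcoh, ← C.assoc₃₂, hVL, C.assoc₃₂, C.assoc₃₂]
  all_goals simp (maxDischargeDepth := 8) [C.assoc₂₁, hΓ, hχ, hω, hΓ₁]

lemma coh_121_comp₃₁_map₃ (i : B.Hom c d) (σ : B.Cell₂ b c) (f : B.Hom a b) (χ : B.Cell₂ a c)
    (ψ : B.Cell₂ a d) (χ' : B.Cell₂ b d) (ω : B.Cell₂ a d) (Γ : B.Cell₃ a d)
    (hχ : B.tgt₁ χ = B.src₁ σ ∘₁₀ f) (hψ : B.tgt₁ ψ = i ∘₁₀ B.src₁ χ)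
    (hχ' : B.tgt₁ χ' = i ∘₁₀ B.src₁ σ) (hω : B.tgt₁ ω = B.src₁ χ' ∘₁₀ f)
    (hsrc : B.src₂ Γ = i ◁₂ χ ∘₂₁ ψ) (htgt : B.tgt₂ Γ = χ' ▷₂ f ∘₂₁ ω) :
    (G.VR i σ ▷₃ G.map f ∘₃₁ G.map₂ χ' ▷₂ G.map f ◃ G.V (B.src₁ χ') f ◃ C.id₃ (G.map₂ ω))
      ∘₃₂ (G.map i ◁₂ G.map₂ σ ▷₂ G.map f ◃ G.V i (B.src₁ σ) ▷₂ G.map f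
        ◃ G.VL χ' f ▹ G.map₂ ω)
      ∘₃₂ (G.map i ◁₂ G.map₂ σ ▷₂ G.map f ◃ G.W i (B.src₁ σ) f ∘₃₁ G.map₃ Γ)
      ∘₃₂ (G.map i ◁₂ G.map₂ σ ▷₂ G.map f ◃ G.map i ◁₂ G.V (B.src₁ σ) f
        ◃ G.VR i χ ▹ G.map₂ ψ)
      ∘₃₂ (G.map i ◁₃ G.VL σ f ∘₃₁ G.map i ◁₂ G.map₂ χ ◃ G.V i (B.src₁ χ) ◃ C.id₃ (G.map₂ ψ))
    = (G.V i (B.tgt₁ σ) ▷₂ G.map f ◃ G.VL (i ◁₂ σ ∘₂₁ χ') f ▹ G.map₂ ω)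
      ∘₃₂ (G.W i (B.tgt₁ σ) f ∘₃₁ G.map₂ (i ◁₂ σ ▷₂ f) ◃ G.map₃ Γ)
      ∘₃₂ (G.map i ◁₂ G.V (B.tgt₁ σ) f ◃ G.VR i (σ ▷₂ f ∘₂₁ χ) ▹ G.map₂ ψ) := by
  have hcoh : (G.V i (B.tgt₁ σ) ▷₂ G.map f ◃ G.VL (i ◁₂ σ) f ▹ G.map₂ (B.tgt₂ Γ))
      ∘₃₂ (G.W i (B.tgt₁ σ) f ∘₃₁ G.map₂ (i ◁₂ σ ▷₂ f) ◃ G.map₃ Γ)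
      ∘₃₂ (G.map i ◁₂ G.V (B.tgt₁ σ) f ◃ G.VR i (σ ▷₂ f) ▹ G.map₂ (B.src₂ Γ))
      = (G.VR i σ ▷₃ G.map f ∘₃₁ G.V (i ∘₁₀ B.src₁ σ) f ◃ C.id₃ (G.map₂ (B.tgt₂ Γ)))
      ∘₃₂ (G.map i ◁₂ G.map₂ σ ▷₂ G.map f ◃ G.W i (B.src₁ σ) f ∘₃₁ G.map₃ Γ)
      ∘₃₂ (G.map i ◁₃ G.VL σ f ∘₃₁ G.V i (B.src₁ σ ∘₁₀ f) ◃ C.id₃ (G.map₂ (B.src₂ Γ))) := by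
    have h₁ := congrArg (fun Θ => Θ ∘₃₁ G.map₃ Γ) (G.isNormalisedOplax.coh_121 i σ f)
    beta_reduce at h₁
    rw [comp₃₂_comp₃₁, comp₃₂_comp₃₁', comp₃₂_comp₃₁, comp₃₂_comp₃₁'] at h₁
    · simpa (maxDischargeDepth := 8) [C.assoc₃₁, C.assoc₂₁, hsrc, htgt, hχ, hψ, hχ', hω] using h₁
    all_goals simp (maxDischargeDepth := 8) [C.assoc₂₁, hsrc, hχ, hψ]
  have hVL : (G.VR i σ ▷₃ G.map f ∘₃₁ G.map₂ χ' ▷₂ G.map f ◃ G.V (B.src₁ χ') f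
        ◃ C.id₃ (G.map₂ ω))
      ∘₃₂ (G.map i ◁₂ G.map₂ σ ▷₂ G.map f ◃ G.V i (B.src₁ σ) ▷₂ G.map f
        ◃ G.VL χ' f ▹ G.map₂ ω)
      = (G.V i (B.tgt₁ σ) ▷₂ G.map f ◃ G.map₂ (i ◁₂ σ) ▷₂ G.map f ◃ G.VL χ' f ▹ G.map₂ ω)
      ∘₃₂ (G.VR i σ ▷₃ G.map f ∘₃₁ G.V (i ∘₁₀ B.src₁ σ) f ◃ C.id₃ (G.map₂ (B.tgt₂ Γ))) := by
    simpa (maxDischargeDepth := 8) [C.assoc₃₁, htgt, hχ', hω] using exchange₃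
      (G.VR i σ ▷₃ G.map f) (G.VL χ' f ▹ G.map₂ ω)
      (by simp (maxDischargeDepth := 8) [hχ', hω])
  have hVR : (G.map i ◁₃ G.VL σ f ∘₃₁ G.V i (B.src₁ σ ∘₁₀ f) ◃ C.id₃ (G.map₂ (B.src₂ Γ)))
      ∘₃₂ (G.map i ◁₂ G.V (B.tgt₁ σ) f ◃ G.map i ◁₂ G.map₂ (σ ▷₂ f) ◃ G.VR i χ ▹ G.map₂ ψ)
      = (G.map i ◁₂ G.map₂ σ ▷₂ G.map f ◃ G.map i ◁₂ G.V (B.src₁ σ) f ◃ G.VR i χ ▹ G.map₂ ψ)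
      ∘₃₂ (G.map i ◁₃ G.VL σ f ∘₃₁ G.map i ◁₂ G.map₂ χ ◃ G.V i (B.src₁ χ)
        ◃ C.id₃ (G.map₂ ψ)) := by
    simpa (maxDischargeDepth := 8) [C.assoc₃₁, hsrc, hχ, hψ] using exchange₃
      (G.map i ◁₃ G.VL σ f) (G.VR i χ ▹ G.map₂ ψ)
      (by simp (maxDischargeDepth := 8) [hχ, hψ])
  rw [← whisker_VL_comp₂₁ G _ _ _ _ _ (B.tgt₂ Γ), ← whisker_VR_comp₂₁ G _ _ _ _ _ (B.src₂ Γ),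
    ← hVR, ← C.assoc₃₂, hVL, C.assoc₃₂, C.assoc₃₂,
    ← C.assoc₃₂ _ _ (_ ◃ _ ◃ G.VR i χ ▹ _), ← C.assoc₃₂ _ _ (_ ◃ _ ◃ G.VR i χ ▹ _),
    ← hcoh, C.assoc₃₂, C.assoc₃₂]
  all_goals simp (maxDischargeDepth := 8) [C.assoc₂₁, hsrc, htgt, hχ, hψ, hχ', hω]

lemma whisker_coh_22 (p : C.Cell₂ (G.obj a) (G.obj c)) (β : B.Cell₂ b c) (α : B.Cell₂ a b)
    (φ : B.Cell₂ a c) (hφ : B.tgt₁ φ = B.src₁ β ∘₁₀ B.src₁ α)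
    (hp : C.src₁ p = G.map (B.tgt₁ β) ∘₁₀ G.map (B.tgt₁ α)) :
    (p ◃ G.map₂ β ▷₂ G.map (B.tgt₁ α) ◃ G.VR (B.src₁ β) α ▹ G.map₂ φ)
      ∘₃₂ (p ◃ G.map (B.tgt₁ β) ◁₂ G.map₂ α ◃ G.VL β (B.src₁ α) ▹ G.map₂ φ)
    = (p ◃ G.VL β (B.tgt₁ α) ∘₃₁ C.id₃ (G.map₂ (B.src₁ β ◁₂ α)) ▹ G.map₂ φ)
      ∘₃₂ (p ◃ G.VR (B.tgt₁ β) α ∘₃₁ C.id₃ (G.map₂ (β ▷₂ B.src₁ α)) ▹ G.map₂ φ) := by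
  have hG := exchange₂_assoc (G.map₂ β) (G.map₂ α)
  have hB := congrArg (fun γ => G.map₂ (γ ∘₂₁ φ)) (exchange₂ β α)
  have hB' := congrArg G.map₂ (exchange₂ β α)
  simp only [src_map₂, tgt_map₂, hφ, tgt₁_comp₂₀, tgt₁_id₂, src₁_comp₂₀, src₁_id₂, src₁_comp₂₁,
    map₂_comp₂₁, C.assoc₂₁] at hG hB hB'
  have h₁ := congrArg (fun Θ => p ◃ Θ ▹ G.map₂ φ) (G.isNormalisedOplax.coh_22 β α)
  beta_reduce at h₁
  simpa (maxDischargeDepth := 8) [C.assoc₂₁, C.assoc₃₁, hφ, hp, hG, hB', hB] using h₁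

end

section

variable (G : NormalisedOplaxFunctor B C) (F : NormalisedOplaxFunctor A B) {a b c d e : A.Obj}
  (i : A.Hom d e) (h : A.Hom c d) (g : A.Hom b c) (f : A.Hom a b)

lemma V_exchange_assoc (γ : B.Cell₂ (F.obj a) (F.obj e))
    (hγ : B.tgt₁ γ = F.map (i ∘₁₀ h) ∘₁₀ F.map (g ∘₁₀ f)) :
    F.V i h ∘₂₀ B.id₂ (F.map g) ∘₂₀ B.id₂ (F.map f) ∘₂₁ F.map (i ∘₁₀ h) ◁₂ F.V g f ∘₂₁ γ
      = F.map i ◁₂ F.map h ◁₂ F.V g f ∘₂₁ F.V i h ▷₂ F.map (g ∘₁₀ f) ∘₂₁ γ := by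
  simpa using exchange₂_assoc (F.V i h) (F.V g f) γ (by simp [hγ])

lemma map₂_V_exchange :
    G.map₂ (F.V i h ∘₂₀ B.id₂ (F.map g) ∘₂₀ B.id₂ (F.map f))
        ∘₂₁ G.map₂ (F.map (i ∘₁₀ h) ◁₂ F.V g f) ∘₂₁ G.map₂ (F.V (i ∘₁₀ h) (g ∘₁₀ f))
      = G.map₂ (F.map i ◁₂ F.map h ◁₂ F.V g f) ∘₂₁ G.map₂ (F.V i h ▷₂ F.map (g ∘₁₀ f))
        ∘₂₁ G.map₂ (F.V (i ∘₁₀ h) (g ∘₁₀ f)) := by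
  simpa [C.assoc₂₁] using congrArg G.map₂
    (F.V_exchange_assoc i h g f (F.V (i ∘₁₀ h) (g ∘₁₀ f)) (by simp))

/-- The composite of instances of `VR G` that moves the images under `G` of the `2`-cells `F(g, f)`
and `F(h, gf)` past the structural `2`-cells of `G`; it is the common initial part of both sides of
the coherence of `GF` for four composable `1`-cells. -/
def pushCell : C.Cell₃ (G.obj (F.obj a)) (G.obj (F.obj e)) :=
  (G.map (F.map i) ◁₂ G.map (F.map h) ◁₂ G.V (F.map g) (F.map f)
      ◃ G.map (F.map i) ◁₂ G.V (F.map h) (F.map g ∘₁₀ F.map f)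
      ◃ G.VR (F.map i) (F.map h ◁₂ F.V g f ∘₂₁ F.V h (g ∘₁₀ f))
      ▹ G.map₂ (F.V i (h ∘₁₀ g ∘₁₀ f)))
    ∘₃₂ (G.map (F.map i) ◁₂ G.map (F.map h) ◁₂ G.V (F.map g) (F.map f)
      ◃ G.map (F.map i) ◁₃ G.VR (F.map h) (F.V g f)
      ∘₃₁ G.map (F.map i) ◁₂ G.map₂ (F.V h (g ∘₁₀ f))
      ◃ G.V (F.map i) (F.map (h ∘₁₀ g ∘₁₀ f))
      ◃ C.id₃ (G.map₂ (F.V i (h ∘₁₀ g ∘₁₀ f))))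

/-- The composite of instances of `VL G` that moves the images under `G` of the `2`-cells `F(i, h)`
and `F(ih, g)` past the structural `2`-cells of `G`; it is the common final part of both sides of
the coherence of `GF` for four composable `1`-cells. -/
def pullCell : C.Cell₃ (G.obj (F.obj a)) (G.obj (F.obj e)) :=
  (G.V (F.map i) (F.map h) ▷₂ G.map (F.map g) ▷₂ G.map (F.map f)
      ◃ G.VL (F.V i h) (F.map g) ▷₃ G.map (F.map f)
      ∘₃₁ G.map₂ (F.V (i ∘₁₀ h) g) ▷₂ G.map (F.map f)
      ◃ G.V (F.map (i ∘₁₀ h ∘₁₀ g)) (F.map f)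
      ◃ C.id₃ (G.map₂ (F.V (i ∘₁₀ h ∘₁₀ g) f)))
    ∘₃₂ (G.V (F.map i) (F.map h) ▷₂ G.map (F.map g) ▷₂ G.map (F.map f)
      ◃ G.V (F.map i ∘₁₀ F.map h) (F.map g) ▷₂ G.map (F.map f)
      ◃ G.VL (F.V i h ▷₂ F.map g ∘₂₁ F.V (i ∘₁₀ h) g) (F.map f)
      ▹ G.map₂ (F.V (i ∘₁₀ h ∘₁₀ g) f))

lemma compData_coh_1111_lhs_eq :
    ((G.compData F).V i h ▷₂ G.map (F.map g) ▷₂ G.map (F.map f) ◃ (G.compData F).W (i ∘₁₀ h) g f)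
      ∘₃₂ (G.map (F.map i) ◁₂ G.map (F.map h) ◁₂ (G.compData F).V g f
        ◃ (G.compData F).W i h (g ∘₁₀ f))
    = G.pullCell F i h g f
      ∘₃₂ (G.V (F.map i) (F.map h) ▷₂ G.map (F.map g) ▷₂ G.map (F.map f)
        ◃ G.W (F.map i ∘₁₀ F.map h) (F.map g) (F.map f)
        ∘₃₁ G.map₂ (F.V i h ▷₂ F.map g ▷₂ F.map f) ◃ G.map₃ (F.W (i ∘₁₀ h) g f))
      ∘₃₂ (G.map (F.map i) ◁₂ G.map (F.map h) ◁₂ G.V (F.map g) (F.map f)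
        ◃ G.W (F.map i) (F.map h) (F.map g ∘₁₀ F.map f)
        ∘₃₁ G.map₂ (F.map i ◁₂ F.map h ◁₂ F.V g f) ◃ G.map₃ (F.W i h (g ∘₁₀ f)))
      ∘₃₂ G.pushCell F i h g f := by
  have hx := exchange₂_assoc (G.map₂ (F.V i h)) (G.V (F.map g) (F.map f))
  have hy := exchange₂_assoc (G.V (F.map i) (F.map h)) (G.map₂ (F.V g f))
  have hw := exchange₂_assoc (G.map₂ (F.V i h)) (G.map₂ (F.V g f))
  have hx' := id₃_exchange₂_assoc (G.map₂ (F.V i h)) (G.V (F.map g) (F.map f))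
  have hz' := id₃_exchange₂_assoc (G.V (F.map i) (F.map h)) (G.V (F.map g) (F.map f))
  have hy' := id₃_exchange₂_assoc (G.V (F.map i) (F.map h)) (G.map₂ (F.V g f))
  simp only [src_V, tgt_V, src_map₂, tgt_map₂, id₂_comp₁₀, assoc₂₀] at hx hy hw hx' hz' hy'
  have hpull := congrArg
    (fun Θ => G.V (F.map i) (F.map h) ▷₂ G.map (F.map g) ▷₂ G.map (F.map f) ◃ Θ)
    (G.coh_211_comp₃₁_map₃ (F.V i h) (F.map g) (F.map f) (F.V (i ∘₁₀ h) g)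
      (F.V (i ∘₁₀ h ∘₁₀ g) f) (F.W (i ∘₁₀ h) g f) (by simp) (by simp) (by simp))
  have hpush := congrArg
    (fun Θ => G.map (F.map i) ◁₂ G.map (F.map h) ◁₂ G.V (F.map g) (F.map f) ◃ Θ)
    (G.coh_112_comp₃₁_map₃ (F.map i) (F.map h) (F.V g f) (F.V h (g ∘₁₀ f))
      (F.V i (h ∘₁₀ g ∘₁₀ f)) (F.W i h (g ∘₁₀ f)) (by simp) (by simp) (by simp))
  have h22 := G.whisker_coh_22
    (G.map (F.map i) ◁₂ G.map (F.map h) ◁₂ G.V (F.map g) (F.map f)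
      ∘₂₁ G.V (F.map i) (F.map h) ▷₂ G.map (F.map g ∘₁₀ F.map f))
    (F.V i h) (F.V g f) (F.V (i ∘₁₀ h) (g ∘₁₀ f)) (by simp) (by simp)
  beta_reduce at hpull hpush
  simp (maxDischargeDepth := 8) only [assoc₂₀, src_V, tgt_V, src_W, src₁_comp₂₀, src₁_id₂,
    map₂_comp₂₁, tgt_map₂, src_map₂, id₃_comp₂₁, src₂_id₃, src₂_comp₃₁, tgt₁_comp₂₁, tgt₁_comp₂₀,
    tgt₁_id₂, src_VL, id₂_comp₁₀, assoc₁₀, src₁_comp₂₁, C.assoc₂₁, tgt₂_comp₃₁, tgt₂_id₃, tgt_VL,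
    src_map₃, hx, tgt₂_comp₃₂, tgt_W, tgt_map₃, src₂_comp₃₂, id₃_comp₃₁_comp₃₂, hz',
    comp₂₁_comp₂₀_id₂, src₂_comp₃₀, src_VR, tgt_VR, hy, id₂_comp₂₀_comp₂₁, tgt₂_comp₃₀, C.assoc₃₁,
    hy'] at hpull hpush h22
  simp (maxDischargeDepth := 8) only [tgt_map₂, tgt_V, src_V, comp₂₁_comp₂₀_id₂, tgt₁_comp₂₀,
    tgt₁_id₂, src₁_comp₂₀, src₁_id₂, assoc₂₀, id₃_comp₂₁, assoc₁₀, src₂_id₃, src_VR, src_map₂,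
    src₁_comp₂₁, src₂_comp₃₁, C.assoc₂₁, tgt₁_comp₂₁, tgt₂_comp₃₁, tgt₂_id₃, tgt_VR, src_map₃,
    src_W, map₂_comp₂₁, tgt₂_comp₃₂, tgt_W, tgt_map₃, src_VL, src₂_comp₃₂, C.assoc₃₁,
    id₃_comp₃₁_comp₃₂, hx', hx, hz', id₂_comp₂₀_comp₂₁, compData, pullCell, pushCell]
  apply comp₃₂_paste_two h22 hpull hpush
  all_goals simp (maxDischargeDepth := 8) [C.assoc₂₁, hx, hy, hw, V_exchange_assoc, map₂_V_exchange]

set_option maxHeartbeats 400000 in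
-- Both sides unfold to long composites, all of whose boundaries are compared.
lemma compData_coh_1111_rhs_eq :
    ((G.compData F).W i h g ▷₃ G.map (F.map f) ▹ (G.compData F).V (i ∘₁₀ h ∘₁₀ g) f)
      ∘₃₂ (G.map (F.map i) ◁₂ (G.compData F).V h g ▷₂ G.map (F.map f)
        ◃ (G.compData F).W i (h ∘₁₀ g) f)
      ∘₃₂ (G.map (F.map i) ◁₃ (G.compData F).W h g f ▹ (G.compData F).V i (h ∘₁₀ g ∘₁₀ f))
    = G.pullCell F i h g f
      ∘₃₂ (G.W (F.map i) (F.map h) (F.map g) ▷₃ G.map (F.map f)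
        ∘₃₁ G.V (F.map i ∘₁₀ F.map h ∘₁₀ F.map g) (F.map f)
          ◃ G.map₃ (F.W i h g ▷₃ F.map f) ▹ G.map₂ (F.V (i ∘₁₀ h ∘₁₀ g) f))
      ∘₃₂ (G.map (F.map i) ◁₂ G.V (F.map h) (F.map g) ▷₂ G.map (F.map f)
        ◃ G.W (F.map i) (F.map h ∘₁₀ F.map g) (F.map f)
        ∘₃₁ G.map₂ (F.map i ◁₂ F.V h g ▷₂ F.map f) ◃ G.map₃ (F.W i (h ∘₁₀ g) f))
      ∘₃₂ (G.map (F.map i) ◁₃ G.W (F.map h) (F.map g) (F.map f)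
        ∘₃₁ G.V (F.map i) (F.map h ∘₁₀ F.map g ∘₁₀ F.map f)
          ◃ G.map₃ (F.map i ◁₃ F.W h g f) ▹ G.map₂ (F.V i (h ∘₁₀ g ∘₁₀ f)))
      ∘₃₂ G.pushCell F i h g f := by
  have h31 := congrArg (· ▹ G.map₂ (F.V (i ∘₁₀ h ∘₁₀ g) f))
    (G.coh_31_comp₃₁ (F.W i h g) (F.map f) (G.W (F.map i) (F.map h) (F.map g)) (by simp))
  have h13 := congrArg (· ▹ G.map₂ (F.V i (h ∘₁₀ g ∘₁₀ f)))
    (G.coh_13_comp₃₁ (F.map i) (F.W h g f) (G.W (F.map h) (F.map g) (F.map f)) (by simp))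
  have h121 := congrArg
    (fun Θ => G.map (F.map i) ◁₂ G.V (F.map h) (F.map g) ▷₂ G.map (F.map f) ◃ Θ)
    (G.coh_121_comp₃₁_map₃ (F.map i) (F.V h g) (F.map f) (F.V (h ∘₁₀ g) f)
      (F.V i (h ∘₁₀ g ∘₁₀ f)) (F.V i (h ∘₁₀ g)) (F.V (i ∘₁₀ h ∘₁₀ g) f) (F.W i (h ∘₁₀ g) f)
      (by simp) (by simp) (by simp) (by simp) (by simp) (by simp))
  beta_reduce at h31 h13 h121
  simp (maxDischargeDepth := 8) only [tgt_W, tgt_V, src₁_comp₂₀, src_V, src₁_id₂,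
    comp₂₁_comp₂₀_id₂, assoc₂₀, tgt₁_comp₂₀, tgt₁_id₂, assoc₁₀, id₃_comp₂₁, src_VL, tgt₁_comp₂₁,
    map₂_comp₂₁, tgt_map₂, src_map₂, src₂_id₃, C.assoc₃₁, src_W, src_map₃, src₂_comp₃₀,
    src₂_comp₃₁, src₁_comp₂₁, tgt₂_comp₃₁, tgt₂_comp₃₀, tgt₂_id₃, tgt_map₃, C.assoc₂₁,
    comp₃₂_comp₃₁_id₃, tgt_VL, id₂_comp₂₀_comp₂₁, src_VR, tgt_VR, tgt₂_comp₃₂, src₂_comp₃₂,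
    id₃_comp₃₁_comp₃₂] at h31 h13 h121
  simp (maxDischargeDepth := 8) only [src₂_id₃, tgt_map₂, tgt_V, src_VR, src_V, src₁_comp₂₀,
    src₁_id₂, src_map₂, src₁_comp₂₁, src₂_comp₃₁, C.assoc₂₁, tgt₁_comp₂₁, tgt₁_comp₂₀, tgt₁_id₂,
    tgt₂_comp₃₁, tgt₂_id₃, tgt_VR, src_map₃, src_W, map₂_comp₂₁, tgt₂_comp₃₂, tgt_W, tgt_map₃,
    assoc₁₀, src_VL, comp₃₂_comp₃₀_id₃_id₂, comp₃₁_comp₃₀_id₃_id₂, id₃_comp₃₀_id₃, assoc₂₀,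
    id₃_comp₂₁, src₂_comp₃₀, comp₂₁_comp₂₀_id₂, tgt₂_comp₃₀, src₂_comp₃₂,
    comp₃₂_comp₃₁_id₃_comp₃₁_id₃, C.assoc₃₁, id₂_comp₂₀_comp₂₁, id₃_comp₃₁_comp₃₂,
    id₃_id₂_comp₃₀_comp₃₂, id₃_id₂_comp₃₀_comp₃₁, compData, pullCell, pushCell]
  apply comp₃₂_paste_three h121 h31.symm h13.symm
  all_goals simp (maxDischargeDepth := 8) [C.assoc₂₁]

lemma map₃_coh_1111 :
    (G.map₂ (F.V i h ▷₂ F.map g ▷₂ F.map f) ◃ G.map₃ (F.W (i ∘₁₀ h) g f))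
      ∘₃₂ (G.map₂ (F.map i ◁₂ F.map h ◁₂ F.V g f) ◃ G.map₃ (F.W i h (g ∘₁₀ f)))
    = (G.map₃ (F.W i h g ▷₃ F.map f) ▹ G.map₂ (F.V (i ∘₁₀ h ∘₁₀ g) f))
      ∘₃₂ (G.map₂ (F.map i ◁₂ F.V h g ▷₂ F.map f) ◃ G.map₃ (F.W i (h ∘₁₀ g) f))
      ∘₃₂ (G.map₃ (F.map i ◁₃ F.W h g f) ▹ G.map₂ (F.V i (h ∘₁₀ g ∘₁₀ f))) := by
  have hcoh := congrArg G.map₃ (F.isNormalisedOplax.coh_1111 i h g f)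
  rw [G.map₃_comp₃₂ (_ ◃ F.W (i ∘₁₀ h) g f) _ (by simp [V_exchange_assoc])] at hcoh
  simpa (maxDischargeDepth := 8) [B.assoc₂₁] using hcoh

lemma coh_1111_comp₃₁_map₃_coh_1111 :
    (G.V (F.map i) (F.map h) ▷₂ G.map (F.map g) ▷₂ G.map (F.map f)
        ◃ G.W (F.map i ∘₁₀ F.map h) (F.map g) (F.map f)
        ∘₃₁ G.map₂ (F.V i h ▷₂ F.map g ▷₂ F.map f) ◃ G.map₃ (F.W (i ∘₁₀ h) g f))
      ∘₃₂ (G.map (F.map i) ◁₂ G.map (F.map h) ◁₂ G.V (F.map g) (F.map f)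
        ◃ G.W (F.map i) (F.map h) (F.map g ∘₁₀ F.map f)
        ∘₃₁ G.map₂ (F.map i ◁₂ F.map h ◁₂ F.V g f) ◃ G.map₃ (F.W i h (g ∘₁₀ f)))
    = (G.W (F.map i) (F.map h) (F.map g) ▷₃ G.map (F.map f)
        ∘₃₁ G.V (F.map i ∘₁₀ F.map h ∘₁₀ F.map g) (F.map f)
          ◃ G.map₃ (F.W i h g ▷₃ F.map f) ▹ G.map₂ (F.V (i ∘₁₀ h ∘₁₀ g) f))
      ∘₃₂ (G.map (F.map i) ◁₂ G.V (F.map h) (F.map g) ▷₂ G.map (F.map f)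
        ◃ G.W (F.map i) (F.map h ∘₁₀ F.map g) (F.map f)
        ∘₃₁ G.map₂ (F.map i ◁₂ F.V h g ▷₂ F.map f) ◃ G.map₃ (F.W i (h ∘₁₀ g) f))
      ∘₃₂ (G.map (F.map i) ◁₃ G.W (F.map h) (F.map g) (F.map f)
        ∘₃₁ G.V (F.map i) (F.map h ∘₁₀ F.map g ∘₁₀ F.map f)
          ◃ G.map₃ (F.map i ◁₃ F.W h g f) ▹ G.map₂ (F.V i (h ∘₁₀ g ∘₁₀ f))) := by
  have hcoh := congrArg₂ C.comp₃₁
    (G.isNormalisedOplax.coh_1111 (F.map i) (F.map h) (F.map g) (F.map f))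
    (G.map₃_coh_1111 F i h g f)
  rw [C.interchange₃₁₂, C.interchange₃₁₂, C.interchange₃₁₂] at hcoh
  · simpa (maxDischargeDepth := 8) [C.assoc₃₁, C.assoc₂₁] using hcoh
  all_goals simp (maxDischargeDepth := 8) [C.assoc₂₁, V_exchange_assoc, map₂_V_exchange]

lemma compData_coh_1111 :
    ((G.compData F).V i h ▷₂ G.map (F.map g) ▷₂ G.map (F.map f) ◃ (G.compData F).W (i ∘₁₀ h) g f)
      ∘₃₂ (G.map (F.map i) ◁₂ G.map (F.map h) ◁₂ (G.compData F).V g f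
        ◃ (G.compData F).W i h (g ∘₁₀ f))
    = ((G.compData F).W i h g ▷₃ G.map (F.map f) ▹ (G.compData F).V (i ∘₁₀ h ∘₁₀ g) f)
      ∘₃₂ (G.map (F.map i) ◁₂ (G.compData F).V h g ▷₂ G.map (F.map f)
        ◃ (G.compData F).W i (h ∘₁₀ g) f)
      ∘₃₂ (G.map (F.map i) ◁₃ (G.compData F).W h g f
        ▹ (G.compData F).V i (h ∘₁₀ g ∘₁₀ f)) := by
  rw [compData_coh_1111_lhs_eq, compData_coh_1111_rhs_eq, ← C.assoc₃₂ _ _ (G.pushCell F i h g f),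
    coh_1111_comp₃₁_map₃_coh_1111, C.assoc₃₂, C.assoc₃₂]
  all_goals simp (maxDischargeDepth := 8) [C.assoc₂₁, pushCell, V_exchange_assoc, map₂_V_exchange]

end

section

variable (F : NormalisedOplaxFunctor A B) {a b c : A.Obj}

@[simp] lemma map_id (a : A.Obj) : F.map (A.id₁ a) = B.id₁ (F.obj a) :=
  F.isNormalisedOplax.map_id a

@[simp] lemma map₂_id (f : A.Hom a b) : F.map₂ (A.id₂ f) = B.id₂ (F.map f) :=
  F.isNormalisedOplax.map₂_id f

@[simp] lemma map₃_id (α : A.Cell₂ a b) : F.map₃ (A.id₃ α) = B.id₃ (F.map₂ α) :=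
  F.isNormalisedOplax.map₃_id α

@[simp] lemma V_id_left (f : A.Hom a b) : F.V (A.id₁ b) f = B.id₂ (F.map f) :=
  F.isNormalisedOplax.V_id_left f

@[simp] lemma V_id_right (f : A.Hom a b) : F.V f (A.id₁ a) = B.id₂ (F.map f) :=
  F.isNormalisedOplax.V_id_right f

@[simp] lemma W_id_right (g : A.Hom b c) (f : A.Hom a b) :
    F.W g f (A.id₁ a) = B.id₃ (F.V g f) := F.isNormalisedOplax.W_id_right g f

@[simp] lemma W_id_middle (g : A.Hom b c) (f : A.Hom a b) :
    F.W g (A.id₁ b) f = B.id₃ (F.V g f) := F.isNormalisedOplax.W_id_middle g f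

@[simp] lemma W_id_left (g : A.Hom b c) (f : A.Hom a b) :
    F.W (A.id₁ c) g f = B.id₃ (F.V g f) := F.isNormalisedOplax.W_id_left g f

@[simp] lemma VR_id₂ (g : A.Hom b c) (f : A.Hom a b) :
    F.VR g (A.id₂ f) = B.id₃ (F.V g f) := F.isNormalisedOplax.VR_id₂ g f

@[simp] lemma VR_id₁ (α : A.Cell₂ a b) : F.VR (A.id₁ b) α = B.id₃ (F.map₂ α) :=
  F.isNormalisedOplax.VR_id₁ α

@[simp] lemma VL_id₂ (g : A.Hom b c) (f : A.Hom a b) :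
    F.VL (A.id₂ g) f = B.id₃ (F.V g f) := F.isNormalisedOplax.VL_id₂ g f

@[simp] lemma VL_id₁ (β : A.Cell₂ a b) : F.VL β (A.id₁ a) = B.id₃ (F.map₂ β) :=
  F.isNormalisedOplax.VL_id₁ β

end

end NormalisedOplaxFunctor

namespace ThreeCat

variable {C : ThreeCat.{u}} {a b c d : C.Obj}

lemma id₃_comp₃₁_id₃ (β α : C.Cell₂ a b) (h : C.tgt₁ α = C.src₁ β) :
    C.id₃ β ∘₃₁ C.id₃ α = C.id₃ (β ∘₂₁ α) := (C.id₃_comp₂₁ β α h).symm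

@[simp] lemma id₂_comp₂₀_id₂_comp₂₁ (α : C.Cell₂ a c) {g : C.Hom b c} {f : C.Hom a b}
    (h : C.tgt₁ α = g ∘₁₀ f) : g ◁₂ C.id₂ f ∘₂₁ α = α := by
  rw [← C.id₂_comp₁₀, id₂_comp₂₁ α h]

@[simp] lemma id₃_id₂_comp₂₀_id₂_comp₃₁ (Γ : C.Cell₃ a c) {g : C.Hom b c} {f : C.Hom a b}
    (h : C.tgt₁ (C.src₂ Γ) = g ∘₁₀ f) : g ◁₂ C.id₂ f ◃ Γ = Γ := by
  rw [← C.id₂_comp₁₀, id₃_id₂_comp₃₁ Γ h]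

@[simp] lemma id₃_id₂_comp₂₀_id₂_comp₂₀_id₂_comp₃₁ (Γ : C.Cell₃ a d) {h : C.Hom c d}
    {g : C.Hom b c} {f : C.Hom a b} (H : C.tgt₁ (C.src₂ Γ) = h ∘₁₀ g ∘₁₀ f) :
    h ◁₂ g ◁₂ C.id₂ f ◃ Γ = Γ := by
  rw [← C.id₂_comp₁₀, ← C.id₂_comp₁₀, id₃_id₂_comp₃₁ Γ H]

end ThreeCat

/-- The conditions defining a normalised oplax `3`-functor that involve only objects and `1`-cells
of the source. -/
structure OplaxData₁.IsNormalisedOplax {A : ThreeCat.{u₁}} {C : ThreeCat.{u₃}}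
    (P : OplaxData₁ A C) : Prop where
  src_V {a b c : A.Obj} (g : A.Hom b c) (f : A.Hom a b) :
    C.src₁ (P.V g f) = P.map (g ∘₁₀ f)
  tgt_V {a b c : A.Obj} (g : A.Hom b c) (f : A.Hom a b) :
    C.tgt₁ (P.V g f) = P.map g ∘₁₀ P.map f
  src_W {a b c d : A.Obj} (h : A.Hom c d) (g : A.Hom b c) (f : A.Hom a b) :
    C.src₂ (P.W h g f) = P.map h ◁₂ P.V g f ∘₂₁ P.V h (g ∘₁₀ f)
  tgt_W {a b c d : A.Obj} (h : A.Hom c d) (g : A.Hom b c) (f : A.Hom a b) :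
    C.tgt₂ (P.W h g f) = P.V h g ▷₂ P.map f ∘₂₁ P.V (h ∘₁₀ g) f
  map_id (a : A.Obj) : P.map (A.id₁ a) = C.id₁ (P.obj a)
  V_id_left {a b : A.Obj} (f : A.Hom a b) : P.V (A.id₁ b) f = C.id₂ (P.map f)
  V_id_right {a b : A.Obj} (f : A.Hom a b) : P.V f (A.id₁ a) = C.id₂ (P.map f)
  W_id_right {a b c : A.Obj} (g : A.Hom b c) (f : A.Hom a b) :
    P.W g f (A.id₁ a) = C.id₃ (P.V g f)
  W_id_middle {a b c : A.Obj} (g : A.Hom b c) (f : A.Hom a b) :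
    P.W g (A.id₁ b) f = C.id₃ (P.V g f)
  W_id_left {a b c : A.Obj} (g : A.Hom b c) (f : A.Hom a b) :
    P.W (A.id₁ c) g f = C.id₃ (P.V g f)
  coh_1111 {a b c d e : A.Obj}
      (i : A.Hom d e) (h : A.Hom c d) (g : A.Hom b c) (f : A.Hom a b) :
    (C.id₃ (P.V i h ∘₂₀ C.id₂ (P.map g) ∘₂₀ C.id₂ (P.map f)) ∘₃₁ P.W (i ∘₁₀ h) g f)
      ∘₃₂ (C.id₃ (C.id₂ (P.map i) ∘₂₀ C.id₂ (P.map h) ∘₂₀ P.V g f) ∘₃₁ P.W i h (g ∘₁₀ f))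
    = (P.W i h g ∘₃₀ C.id₃ (C.id₂ (P.map f)) ∘₃₁ C.id₃ (P.V (i ∘₁₀ h ∘₁₀ g) f))
      ∘₃₂ (C.id₃ (C.id₂ (P.map i) ∘₂₀ P.V h g ∘₂₀ C.id₂ (P.map f)) ∘₃₁ P.W i (h ∘₁₀ g) f)
      ∘₃₂ (C.id₃ (C.id₂ (P.map i)) ∘₃₀ P.W h g f ∘₃₁ C.id₃ (P.V i (h ∘₁₀ g ∘₁₀ f)))

open ThreeCat in
lemma NormalisedOplaxFunctor.isNormalisedOplax_compData {A : ThreeCat.{u₁}} {B : ThreeCat.{u₂}}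
    {C : ThreeCat.{u₃}} (G : NormalisedOplaxFunctor B C) (F : NormalisedOplaxFunctor A B) :
    (G.compData F).IsNormalisedOplax where
  src_V g f := by simp [compData]
  tgt_V g f := by simp [compData]
  src_W h g f := by simp (maxDischargeDepth := 8) [compData, C.assoc₂₁]
  tgt_W h g f := by simp (maxDischargeDepth := 8) [compData, C.assoc₂₁]
  map_id a := by simp [compData]
  V_id_left f := by simp [compData]
  V_id_right f := by simp [compData]
  W_id_right g f := by simp (maxDischargeDepth := 8) [compData, -id₃_comp₂₁, id₃_comp₃₁_id₃]
  W_id_middle g f := by simp (maxDischargeDepth := 8) [compData, -id₃_comp₂₁, id₃_comp₃₁_id₃]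
  W_id_left g f := by simp (maxDischargeDepth := 8) [compData, -id₃_comp₂₁, id₃_comp₃₁_id₃]
  coh_1111 i h g f := by
    rw [← C.assoc₂₀]
    exact G.compData_coh_1111 F i h g f

namespace OplaxData₁

open ThreeCat

variable {A : ThreeCat.{u₁}} {C : ThreeCat.{u₃}}

/-- The extension by identities of data on objects and `1`-cells to `2`- and `3`-cells; it is
meant for a source that is a `1`-category. -/
def extendById (P : OplaxData₁ A C) : OplaxData A C where
  toOplaxData₁ := P
  map₂ α := C.id₂ (P.map (A.src₁ α))
  VR g α := C.id₃ (P.V g (A.src₁ α))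
  VL β f := C.id₃ (P.V (A.src₁ β) f)
  map₃ Γ := C.id₃ (C.id₂ (P.map (A.src₁ (A.src₂ Γ))))

variable {P : OplaxData₁ A C}

attribute [local simp] extendById IsNormalisedOplax.src_V IsNormalisedOplax.tgt_V
  IsNormalisedOplax.src_W IsNormalisedOplax.tgt_W

lemma IsNormalisedOplax.extendById (hP : P.IsNormalisedOplax) (hA : A.IsOneCategory) :
    P.extendById.IsNormalisedOplax where
  src_V := hP.src_V
  tgt_V := hP.tgt_V
  src_map₂ α := by simp
  tgt_map₂ α := by obtain ⟨f, rfl⟩ := hA.cell₂_eq α; simp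
  src_W := hP.src_W
  tgt_W := hP.tgt_W
  src_VR g α := by obtain ⟨f, rfl⟩ := hA.cell₂_eq α; simp [hP]
  tgt_VR g α := by obtain ⟨f, rfl⟩ := hA.cell₂_eq α; simp [hP]
  src_VL β f := by obtain ⟨g, rfl⟩ := hA.cell₂_eq β; simp [hP]
  tgt_VL β f := by obtain ⟨g, rfl⟩ := hA.cell₂_eq β; simp [hP]
  src_map₃ Γ := by simp
  tgt_map₃ Γ := by simp
  map_id := hP.map_id
  map₂_id f := by simp
  V_id_left := hP.V_id_left
  V_id_right := hP.V_id_right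
  map₃_id α := by simp
  W_id_right := hP.W_id_right
  W_id_middle := hP.W_id_middle
  W_id_left := hP.W_id_left
  VR_id₂ g f := by simp
  VR_id₁ α := by simp [hP.V_id_left]
  VL_id₂ g f := by simp
  VL_id₁ β := by simp [hP.V_id_right]
  coh_Y β α h := by
    obtain ⟨f, rfl⟩ := hA.cell₂_eq α
    obtain rfl : f = A.src₁ β := by simpa using h
    simp
  coh_1111 := hP.coh_1111
  coh_211 α g f := by
    obtain ⟨h, rfl⟩ := hA.cell₂_eq α
    simp (maxDischargeDepth := 8) [hP, -id₃_comp₂₁, id₃_comp₃₁_id₃]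
  coh_121 h α f := by
    obtain ⟨g, rfl⟩ := hA.cell₂_eq α
    simp (maxDischargeDepth := 8) [hP, -id₃_comp₂₁, id₃_comp₃₁_id₃]
  coh_112 h g α := by
    obtain ⟨f, rfl⟩ := hA.cell₂_eq α
    simp (maxDischargeDepth := 8) [hP, -id₃_comp₂₁, id₃_comp₃₁_id₃]
  coh_VR_Y g β α h := by
    obtain ⟨f, rfl⟩ := hA.cell₂_eq α
    obtain rfl : f = A.src₁ β := by simpa using h
    simp [hP]
  coh_VL_Y β α f h := by
    obtain ⟨g, rfl⟩ := hA.cell₂_eq α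
    obtain rfl : g = A.src₁ β := by simpa using h
    simp [hP]
  coh_22 β α := by
    obtain ⟨f, rfl⟩ := hA.cell₂_eq α
    obtain ⟨g, rfl⟩ := hA.cell₂_eq β
    simp [hP]
  coh_YY γ β α h h' := by
    obtain ⟨f, rfl⟩ := hA.cell₂_eq α
    obtain ⟨g, rfl⟩ := hA.cell₂_eq β
    obtain rfl : f = g := by simpa using h
    simp [show f = A.src₁ γ by simpa using h']
  map₃_comp₃₂ Δ Γ h := by
    have h' : A.src₁ (A.src₂ Γ) = A.src₁ (A.src₂ Δ) := by rw [A.src₁_src₂, h]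
    simp [h, h']
  map₃_whisker_right Γ α h := by
    obtain ⟨f, rfl⟩ := hA.cell₂_eq α
    simp_all
  map₃_whisker_left β Γ h := by
    obtain ⟨α, rfl⟩ := hA.cell₃_eq Γ
    obtain ⟨f, rfl⟩ := hA.cell₂_eq α
    simp_all
  coh_31 Γ f := by
    obtain ⟨α, rfl⟩ := hA.cell₃_eq Γ
    obtain ⟨g, rfl⟩ := hA.cell₂_eq α
    simp [hP]
  coh_13 g Γ := by
    obtain ⟨α, rfl⟩ := hA.cell₃_eq Γ
    obtain ⟨f, rfl⟩ := hA.cell₂_eq α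
    simp [hP]

end OplaxData₁

lemma ThreeCat.IsOneCategory.toOplaxData₁_injective {A : ThreeCat.{u₁}} {C : ThreeCat.{u₃}}
    (hA : A.IsOneCategory) :
    Function.Injective fun H : NormalisedOplaxFunctor A C => H.toOplaxData₁ := by
  rintro ⟨⟨P, map₂, VR, VL, map₃⟩, hP⟩ ⟨⟨Q, map₂', VR', VL', map₃'⟩, hQ⟩ h
  obtain rfl : P = Q := h
  obtain rfl : @map₂ = @map₂' := by
    funext a b α
    obtain ⟨f, rfl⟩ := hA.cell₂_eq α
    exact (hP.map₂_id f).trans (hQ.map₂_id f).symm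
  obtain rfl : @VR = @VR' := by
    funext a b c g α
    obtain ⟨f, rfl⟩ := hA.cell₂_eq α
    exact (hP.VR_id₂ g f).trans (hQ.VR_id₂ g f).symm
  obtain rfl : @VL = @VL' := by
    funext a b c β f
    obtain ⟨g, rfl⟩ := hA.cell₂_eq β
    exact (hP.VL_id₂ g f).trans (hQ.VL_id₂ g f).symm
  obtain rfl : @map₃ = @map₃' := by
    funext a b Γ
    obtain ⟨α, rfl⟩ := hA.cell₃_eq Γ
    exact (hP.map₃_id α).trans (hQ.map₃_id α).symm
  rfl

theorem mainTheorem6 (A : ThreeCat.{u₁}) (B : ThreeCat.{u₂}) (C : ThreeCat.{u₃})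
    (hA : A.IsOneCategory)
    (F : NormalisedOplaxFunctor A B) (G : NormalisedOplaxFunctor B C) :
    ∃! GF : NormalisedOplaxFunctor A C, GF.toOplaxData₁ = G.compData F :=
  ⟨⟨(G.compData F).extendById, (G.isNormalisedOplax_compData F).extendById hA⟩, rfl,
    fun _ h => hA.toOplaxData₁_injective h⟩
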